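/- Let $\mathbb F_q$ be any finite field. A code is a linear subspace $C\subseteq\mathbb F_q^n$; its dual is $C^\perp=\{x\in\mathbb F_q^n : x\cdot y=0\ \forall y\in C\}$, where $x\cdot y=\sum_i x_iy_i$. For codes $C_1,C_2\subseteq\mathbb F_q^n$, let $C_1\otimes\mathbb F_q^n$ (resp. $\mathbb F_q^n\otimes C_2$) be the space of $n\times n$ matrices over $\mathbb F_q$ all of whose columns lie in $C_1$ (resp. all of whose rows lie in $C_2$). The pair $(C_1,C_2)$ is called $\rho$-product-expanding if every $x\in C_1\otimes\mathbb F_q^n+\mathbb F_q^n\otimes C_2$ can be written as $x=c+r$ with $c\in C_1\otimes\mathbb F_q^n$ and $r\in\mathbb F_q^n\otimes C_2$ such that $$|x|\ \ge\ \rho\, n\,\bigl(|c|_{\mathrm{col}}+|r|_{\mathrm{row}}\bigr),$$ where $|x|$ is the number of nonzero entries of $x$, $|c|_{\mathrm{col}}$ is the number of nonzero columns of $c$, and $|r|_{\mathrm{row}}$ is the number of nonzero rows of $r$. **Proposition.** Fix a finite field $\mathbb F_q$. For every $\epsilon>0$ there exist a constant $\rho>0$ and a function $\delta:\mathbb N\to\mathbb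 R$ with $\delta(n)\to0$ as $n\to\infty$ (both depending only on $q$ and $\epsilon$) such that the following holds. For every $n$ and every pair of integers $k_1,k_2\in(\epsilon n,(1-\epsilon)n)$, if $C_1,C_2\subseteq\mathbb F_q^n$ are drawn independently, $C_i$ uniformly at random from the set of linear codes of dimension $k_i$ that contain the all-ones vector $\mathbf 1\in\mathbb F_q^n$, then with probability at least $1-\delta(n)$ both $(C_1,C_2^\perp)$ and $(C_1^\perp,C_2)$ are $\rho$-product-expanding. -/

import Mathlib

open MeasureTheory ProbabilityTheory Filter Topology

/-- The dual code `C^⊥ = {x : x · y = 0 for all y ∈ C}` with respect to the standard bilinear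
dot product. -/
def dualCode {F : Type*} [Field F] {ι : Type*} [Fintype ι] (C : Submodule F (ι → F)) :
    Submodule F (ι → F) where
  carrier := {x | ∀ y ∈ C, x ⬝ᵥ y = 0}
  add_mem' := by
    intro a b ha hb y hy
    rw [add_dotProduct, ha y hy, hb y hy, add_zero]
  zero_mem' := by
    intro y _
    exact zero_dotProduct y
  smul_mem' := by
    intro c x hx y hy
    rw [smul_dotProduct, hx y hy, smul_zero]

/-- The tensor code `C₁ ⊗ C₂`: matrices all of whose columns lie in `C₁` and all of whose rows
lie in `C₂`. -/
def tensorCode {F : Type*} [Field F] {ι κ : Type*} (C₁ : Submodule F (ι → F))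
    (C₂ : Submodule F (κ → F)) : Submodule F (Matrix ι κ F) where
  carrier := {x | (∀ j, (fun i => x i j) ∈ C₁) ∧ ∀ i, (fun j => x i j) ∈ C₂}
  add_mem' := by
    rintro a b ⟨ha, ha'⟩ ⟨hb, hb'⟩
    exact ⟨fun j => C₁.add_mem (ha j) (hb j), fun i => C₂.add_mem (ha' i) (hb' i)⟩
  zero_mem' := ⟨fun _ => C₁.zero_mem, fun _ => C₂.zero_mem⟩
  smul_mem' := by
    rintro c x ⟨hx, hx'⟩
    exact ⟨fun j => C₁.smul_mem c (hx j), fun i => C₂.smul_mem c (hx' i)⟩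

/-- The Hamming weight `|x|` of a matrix: its number of nonzero entries. -/
noncomputable def matrixWeight {F : Type*} [Zero F] {ι κ : Type*} (x : Matrix ι κ F) : ℕ :=
  {p : ι × κ | x p.1 p.2 ≠ 0}.ncard

/-- The number of nonzero columns of a matrix. -/
noncomputable def colWeight {F : Type*} [Zero F] {ι κ : Type*} (x : Matrix ι κ F) : ℕ :=
  {j : κ | ∃ i, x i j ≠ 0}.ncard

/-- The number of nonzero rows of a matrix. -/
noncomputable def rowWeight {F : Type*} [Zero F] {ι κ : Type*} (x : Matrix ι κ F) : ℕ :=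
  {i : ι | ∃ j, x i j ≠ 0}.ncard

/-- `(C₁, C₂)` is `ρ`-product-expanding: every `x ∈ C₁ ⊗ F^n + F^n ⊗ C₂` can be written as
`x = c + r` with `c ∈ C₁ ⊗ F^n`, `r ∈ F^n ⊗ C₂` and `|x| ≥ ρ n (|c|_col + |r|_row)`. -/
def IsProductExpanding {F : Type*} [Field F] {n : ℕ} (ρ : ℝ)
    (C₁ C₂ : Submodule F (Fin n → F)) : Prop :=
  ∀ x ∈ tensorCode C₁ (⊤ : Submodule F (Fin n → F)) ⊔
      tensorCode (⊤ : Submodule F (Fin n → F)) C₂,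
    ∃ c ∈ tensorCode C₁ (⊤ : Submodule F (Fin n → F)),
      ∃ r ∈ tensorCode (⊤ : Submodule F (Fin n → F)) C₂,
        x = c + r ∧
          ρ * (n : ℝ) * ((colWeight c : ℝ) + (rowWeight r : ℝ)) ≤ (matrixWeight x : ℝ)

/-- The set of linear codes of block length `n` and dimension `k` that contain the all-ones
vector. -/
def plantedCodes (F : Type*) [Field F] (n k : ℕ) : Set (Submodule F (Fin n → F)) :=
  {C | Module.finrank F C = k ∧ (1 : Fin n → F) ∈ C}

/-- Codes of block length `n` over `F` carry the discrete `σ`-algebra. -/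
instance codeMeasurableSpace {F : Type*} [Field F] {n : ℕ} :
    MeasurableSpace (Submodule F (Fin n → F)) := ⊤

/-! All four random codes (each planted code and its dual) satisfy one first-moment bound,
`IsSpread`: a fixed subspace `T` is contained in the code with probability at most `p ^ dim T`,
where `p` is exponentially small in `n`; only the line through the all-ones vector is exempt. Both
claims of the theorem then follow from one statement about two independent spread codes `D₁`, `D₂`.

Let `x` lie in the sum of the two tensor codes. If `x` has weight of order `n²`, any decomposition
works. If it is sparse of rank at least `2 * t₀`, with `t₀` linear in `n`, membership has
probability `q ^ (-Ω(n²))`, which beats the number of sparse matrices, so with high probability no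
such `x` occurs (`IsSpread.measureReal_mem_sup_tensorCode_le`).

The remaining case, sparse and of low rank, is deterministic once both codes are robust
(`IsRobust`), which holds with high probability (`IsSpread.measureReal_not_isRobust_le`). Erase the
few heavy rows `A` and heavy columns `B` of `x`. The remainder has light rows and columns and lies
in the tensor sum of the codes enlarged by the coordinates in `A` and `B`; by rank–nullity, its
column space or its row space meets the corresponding enlarged code in at least half of its
dimension, so robustness makes it zero (`eq_zero_of_isRobust`). Hence `x` lives on the heavy lines,
and a decomposition can be corrected to live there too (`exists_decomposition_supported`). -/

/-! ### Counting the subspaces of given dimension between two subspaces -/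

section SubspaceCounting

open Module Submodule

variable {F : Type*} [Field F] {V : Type*} [AddCommGroup V] [Module F V]

theorem Submodule.exists_dual_ne_zero_ne_zero {T : Submodule F V} {v v' : V}
    (hv : v ∉ T) (hv' : v' ∉ T) :
    ∃ f : V →ₗ[F] F, f v ≠ 0 ∧ f v' ≠ 0 ∧ T ≤ LinearMap.ker f := by
  obtain ⟨f, hf, hfT⟩ := Submodule.exists_le_ker_of_notMem hv
  obtain ⟨g, hg, hgT⟩ := Submodule.exists_le_ker_of_notMem hv'
  by_cases h1 : f v' = 0
  · by_cases h2 : g v = 0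
    · refine ⟨f + g, by simpa [h2] using hf, by simpa [h1] using hg, fun x hx => ?_⟩
      have := hfT hx
      have := hgT hx
      simp_all
    · exact ⟨g, h2, hg, hgT⟩
  · exact ⟨f, hf, h1, hfT⟩

/-- The map is `x ↦ x + (f x / f v) • (v' - v)`, with `f` vanishing on `T`. It is invertible because
`f v' ≠ 0`, and it preserves `S` because `v' - v ∈ S`. -/
theorem Submodule.exists_linearEquiv_fixing {S T : Submodule F V} {v v' : V}
    (hv : v ∉ T) (hv' : v' ∉ T) (hvS : v ∈ S) (hvS' : v' ∈ S) :
    ∃ e : V ≃ₗ[F] V, T.map (e : V →ₗ[F] V) = T ∧ S.map (e : V →ₗ[F] V) = S ∧ e v = v' := by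
  obtain ⟨f, hf, hf', hfT⟩ := Submodule.exists_dual_ne_zero_ne_zero hv hv'
  have hT : ∀ x ∈ T, f x = 0 := fun x hx => hfT hx
  set u := v' - v with hu
  have huS : u ∈ S := S.sub_mem hvS' hvS
  have hfu : f u = f v' - f v := by simp [hu]
  let a : V →ₗ[F] V := LinearMap.id + (f.smulRight ((f v)⁻¹ • u))
  let b : V →ₗ[F] V := LinearMap.id - (f.smulRight ((f v')⁻¹ • u))
  have hax : ∀ x, a x = x + (f x * (f v)⁻¹) • u := fun x => by simp [a, mul_smul]
  have hbx : ∀ x, b x = x - (f x * (f v')⁻¹) • u := fun x => by simp [b, mul_smul]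
  let e : V ≃ₗ[F] V := LinearEquiv.ofLinearMap a b
    (by
      ext x
      simp only [LinearMap.comp_apply, hax, hbx, map_sub, map_smul, smul_eq_mul, hfu,
        LinearMap.id_apply]
      rw [sub_add, sub_eq_self, ← sub_smul]
      convert zero_smul F u
      field_simp
      ring)
    (by
      ext x
      simp only [LinearMap.comp_apply, hax, hbx, map_add, map_smul, smul_eq_mul, hfu,
        LinearMap.id_apply]
      rw [add_sub_assoc, add_eq_left, ← sub_smul]
      convert zero_smul F u
      field_simp
      ring)
  have hex : ∀ x, e x = x + (f x * (f v)⁻¹) • u := hax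
  have hex' : ∀ x, e.symm x = x - (f x * (f v')⁻¹) • u := hbx
  refine ⟨e, ?_, ?_, ?_⟩
  · ext x
    constructor
    · rintro ⟨y, hy, rfl⟩
      simpa [hex, hT y hy] using hy
    · intro hx
      exact ⟨x, hx, by simp [hex, hT x hx]⟩
  · ext x
    constructor
    · rintro ⟨y, hy, rfl⟩
      simpa [hex] using S.add_mem hy (S.smul_mem _ huS)
    · intro hx
      exact ⟨e.symm x, by simpa [hex'] using S.sub_mem hx (S.smul_mem _ huS), by simp⟩
  · rw [hex, mul_inv_cancel₀ hf, one_smul, hu]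
    abel

/-- The subspaces of dimension `d` between `T` and `S`. -/
def subspacesBetween (d : ℕ) (T S : Submodule F V) : Set (Submodule F V) :=
  {D | finrank F D = d ∧ T ≤ D ∧ D ≤ S}

theorem ncard_subspacesBetween_map (d : ℕ) (T S : Submodule F V) (e : V ≃ₗ[F] V) :
    (subspacesBetween d (T.map (e : V →ₗ[F] V)) (S.map (e : V →ₗ[F] V))).ncard =
      (subspacesBetween d T S).ncard := by
  rw [← Set.ncard_image_of_injective (subspacesBetween d T S)
    (Submodule.map_injective_of_injective (f := (e : V →ₗ[F] V)) e.injective)]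
  congr 1
  ext D
  constructor
  · rintro ⟨h1, h2, h3⟩
    refine ⟨D.map (e.symm : V →ₗ[F] V), ⟨?_, ?_, ?_⟩, ?_⟩
    · rw [← h1]; exact LinearEquiv.finrank_map_eq e.symm D
    · rintro x hx
      exact ⟨e x, h2 ⟨x, hx, rfl⟩, by simp⟩
    · rintro _ ⟨x, hx, rfl⟩
      obtain ⟨y, hy, rfl⟩ := h3 hx
      simpa using hy
    · ext x
      constructor
      · rintro ⟨_, ⟨y, hy, rfl⟩, rfl⟩
        simpa using hy
      · intro hx
        exact ⟨e.symm x, ⟨x, hx, rfl⟩, by simp⟩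
  · rintro ⟨D, ⟨h1, h2, h3⟩, rfl⟩
    exact ⟨by rw [← h1]; exact LinearEquiv.finrank_map_eq e D, Submodule.map_mono h2,
      Submodule.map_mono h3⟩

variable [Fintype F] [Finite V]

theorem Submodule.ncard_eq_pow_finrank (T : Submodule F V) :
    (T : Set V).ncard = Fintype.card F ^ finrank F T := by
  rw [← Nat.card_coe_set_eq, ← Nat.card_eq_fintype_card (α := F)]
  exact Module.natCard_eq_pow_finrank (K := F) (V := T)

/-- Double counting of pairs `(w, D)` with `w ∈ D \ T`: by the symmetry just constructed, the number
of `D` through `w` does not depend on `w ∈ S \ T`. -/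
theorem ncard_subspacesBetween_sup_span {d : ℕ} {T S : Submodule F V} (hTS : T ≤ S) {v : V}
    (hv : v ∉ T) (hvS : v ∈ S) :
    (subspacesBetween d (T ⊔ span F {v}) S).ncard *
        (Fintype.card F ^ finrank F S - Fintype.card F ^ finrank F T) =
      (subspacesBetween d T S).ncard * (Fintype.card F ^ d - Fintype.card F ^ finrank F T) := by
  classical
  have := Fintype.ofFinite V
  have := Fintype.ofFinite (Submodule F V)
  have hdiff : ∀ D : Submodule F V, T ≤ D → ((D : Set V) \ T).toFinset.card =
      Fintype.card F ^ finrank F D - Fintype.card F ^ finrank F T := by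
    intro D hD
    rw [← Set.ncard_eq_toFinset_card', Set.ncard_sdiff hD, Submodule.ncard_eq_pow_finrank,
      Submodule.ncard_eq_pow_finrank]
  have key := Finset.sum_card_bipartiteAbove_eq_sum_card_bipartiteBelow
    (s := ((S : Set V) \ T).toFinset) (t := (subspacesBetween d T S).toFinset)
    (fun (v : V) (D : Submodule F V) => v ∈ D)
  rw [Finset.sum_const_nat (m := (subspacesBetween d (T ⊔ span F {v}) S).ncard),
    Finset.sum_const_nat (m := Fintype.card F ^ d - Fintype.card F ^ finrank F T),
    hdiff S hTS, mul_comm] at key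
  · rw [key, Set.ncard_eq_toFinset_card']
  · intro D hD
    obtain ⟨rfl, h2, h3⟩ := Set.mem_toFinset.1 hD
    rw [← hdiff D h2]
    congr 1
    ext x
    simp only [Finset.mem_bipartiteBelow, Set.mem_toFinset, Set.mem_sdiff, SetLike.mem_coe]
    exact ⟨fun h => ⟨h.2, h.1.2⟩, fun h => ⟨⟨h3 h.1, h.2⟩, h.1⟩⟩
  · intro w hw
    simp only [Set.mem_toFinset, Set.mem_sdiff, SetLike.mem_coe] at hw
    obtain ⟨e, heT, heS, hev⟩ := Submodule.exists_linearEquiv_fixing hv hw.2 hvS hw.1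
    rw [← ncard_subspacesBetween_map d _ S e, heS, Submodule.map_sup, heT, Submodule.map_span,
      Set.image_singleton, LinearEquiv.coe_coe, hev, Set.ncard_eq_toFinset_card']
    congr 1
    ext D
    rw [Finset.mem_bipartiteAbove, Set.mem_toFinset, Set.mem_toFinset]
    refine ⟨fun h => ⟨h.1.1, sup_le h.1.2.1 ((Submodule.span_singleton_le_iff_mem _ _).2 h.2),
      h.1.2.2⟩, fun h => ⟨⟨h.1, le_sup_left.trans h.2.1, h.2.2⟩, ?_⟩⟩
    exact (Submodule.span_singleton_le_iff_mem _ _).1 (le_sup_right.trans h.2.1)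

/-- Each further dimension imposed on `D` costs the ratio `(q^d - q^t) / (q^(dim S) - q^t) ≤ q^(d -
dim S)`. -/
theorem ncard_subspacesBetween_mul_pow_le {d : ℕ} {S : Submodule F V} (hd : d ≤ finrank F S)
    {T T' : Submodule F V} (hTT' : T ≤ T') (hT'S : T' ≤ S) :
    (subspacesBetween d T' S).ncard *
        (Fintype.card F ^ (finrank F S - d)) ^ (finrank F T' - finrank F T) ≤
      (subspacesBetween d T S).ncard := by
  have hq : 1 < Fintype.card F := Fintype.one_lt_card
  have : FiniteDimensional F V := Module.Finite.of_finite
  induction hr : finrank F T' - finrank F T generalizing T with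
  | zero =>
    have : T = T' := Submodule.eq_of_le_of_finrank_le hTT' (by omega)
    simp [this]
  | succ r ih =>
    obtain ⟨v, hvT', hv⟩ := SetLike.exists_of_lt (lt_of_le_of_ne hTT' (by
      rintro rfl; simp at hr))
    have hle : T ⊔ span F {v} ≤ T' :=
      sup_le hTT' ((Submodule.span_singleton_le_iff_mem _ _).2 hvT')
    have hfin : finrank F ↥(T ⊔ span F {v}) = finrank F T + 1 := 
      Submodule.finrank_sup_span_singleton hv
    have h1 := ih hle (by omega)
    have h2 := ncard_subspacesBetween_sup_span (d := d) (hTT'.trans hT'S) hv (hT'S hvT')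
    have hlt : Fintype.card F ^ finrank F T < Fintype.card F ^ finrank F S :=
      Nat.pow_lt_pow_right hq
        (by have := Submodule.finrank_mono (hle.trans hT'S); omega)
    have hsplit : Fintype.card F ^ finrank F S =
        Fintype.card F ^ d * Fintype.card F ^ (finrank F S - d) := by
      rw [← pow_add]; congr 1; omega
    have h3 : (subspacesBetween d (T ⊔ span F {v}) S).ncard *
        Fintype.card F ^ (finrank F S - d) ≤ (subspacesBetween d T S).ncard := by
      refine Nat.le_of_mul_le_mul_right ?_ (Nat.sub_pos_of_lt hlt)
      rw [mul_right_comm, h2, mul_assoc]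
      refine Nat.mul_le_mul_left _ ?_
      rw [Nat.sub_mul, ← hsplit]
      exact Nat.sub_le_sub_left (Nat.le_mul_of_pos_right _ (by positivity)) _
    calc _ = (subspacesBetween d T' S).ncard *
          (Fintype.card F ^ (finrank F S - d)) ^ r * Fintype.card F ^ (finrank F S - d) := by
          rw [pow_succ, mul_assoc]
      _ ≤ _ := (Nat.mul_le_mul_right _ h1).trans h3

end SubspaceCounting

/-! ### Duality for the dot product -/

section Dual

open Module

variable {F : Type*} [Field F] {ι : Type*} [Fintype ι]

theorem mem_dualCode {C : Submodule F (ι → F)} {x : ι → F} :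
    x ∈ dualCode C ↔ ∀ y ∈ C, x ⬝ᵥ y = 0 := Iff.rfl

theorem le_dualCode_comm {C D : Submodule F (ι → F)} : C ≤ dualCode D ↔ D ≤ dualCode C := by
  constructor <;> intro h x hx y hy <;> rw [dotProduct_comm] <;> exact h hy x hx

theorem dualCode_eq_orthogonal (C : Submodule F (ι → F)) :
    dualCode C = LinearMap.BilinForm.orthogonal (dotProductBilin F F) C := by
  ext x
  rw [mem_dualCode, LinearMap.BilinForm.mem_orthogonal_iff]
  refine forall₂_congr fun y _ => ?_
  rw [dotProduct_comm]
  rfl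

theorem dotProductBilin_nondegenerate :
    LinearMap.BilinForm.Nondegenerate (dotProductBilin F F : LinearMap.BilinForm F (ι → F)) := by
  constructor
  · intro x hx
    exact dotProduct_eq_zero x hx
  · intro x hx
    refine dotProduct_eq_zero x fun y => ?_
    rw [dotProduct_comm]
    exact hx y

theorem finrank_dualCode (C : Submodule F (ι → F)) :
    finrank F (dualCode C) = Fintype.card ι - finrank F C := by
  rw [dualCode_eq_orthogonal, LinearMap.BilinForm.finrank_orthogonal dotProductBilin_nondegenerate,
    Module.finrank_pi]

theorem dualCode_dualCode (C : Submodule F (ι → F)) : dualCode (dualCode C) = C := by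
  simp_rw [dualCode_eq_orthogonal]
  refine LinearMap.BilinForm.orthogonal_orthogonal dotProductBilin_nondegenerate ?_ C
  intro x y h
  exact (dotProduct_comm _ _).trans h

theorem dualCode_injective :
    Function.Injective (dualCode : Submodule F (ι → F) → Submodule F (ι → F)) :=
  Function.LeftInverse.injective dualCode_dualCode

end Dual

/-! ### Containment probabilities for planted codes and their duals -/

section Spread

open Module Submodule

variable {F : Type*} [Field F]

/-- A random subspace `D` contains each fixed subspace `T`, other than the line through `u`,
with probability at most `p ^ dim T`. -/
def IsSpread {V : Type*} [AddCommGroup V] [Module F V] {Ω : Type*} [MeasurableSpace Ω]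
    (μ : Measure Ω) (D : Ω → Submodule F V) (u : V) (p : ℝ) : Prop :=
  ∀ T : Submodule F V, T ≠ span F {u} → μ.real {ω | T ≤ D ω} ≤ p ^ finrank F T

instance {n : ℕ} : DiscreteMeasurableSpace (Submodule F (Fin n → F)) := ⟨fun _ => trivial⟩

theorem uniformOn_real {Ω : Type*} [Finite Ω] [MeasurableSpace Ω] [DiscreteMeasurableSpace Ω]
    (s t : Set Ω) : (uniformOn s).real t = ((s ∩ t).ncard : ℝ) / s.ncard := by
  classical
  have := Fintype.ofFinite Ω
  have h := uniformOn_apply_finset (s := s.toFinset) (t := t.toFinset)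
  rw [Set.coe_toFinset, Set.coe_toFinset] at h
  rw [Measure.real, h, ENNReal.toReal_div, ENNReal.toReal_natCast, ENNReal.toReal_natCast,
    ← Set.toFinset_inter, ← Set.ncard_eq_toFinset_card', ← Set.ncard_eq_toFinset_card']

theorem plantedCodes_eq (n k : ℕ) :
    plantedCodes F n k = subspacesBetween k (span F {1}) ⊤ := by
  ext C
  simp only [plantedCodes, subspacesBetween, Submodule.span_singleton_le_iff_mem, le_top, and_true]

theorem plantedCodes_nonempty {n k : ℕ} (hk : 0 < k) (hkn : k ≤ n) :
    (plantedCodes F n k).Nonempty := by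
  induction k, hk using Nat.le_induction with
  | base =>
    have : NeZero n := ⟨by omega⟩
    exact ⟨span F {1}, finrank_span_singleton one_ne_zero, mem_span_singleton_self _⟩
  | succ k hk ih =>
    obtain ⟨C, hC, h1⟩ := ih (by omega)
    obtain ⟨v, hv⟩ : ∃ v, v ∉ C := by
      by_contra! h
      rw [eq_top_iff'.2 h, finrank_top, finrank_pi, Fintype.card_fin] at hC
      omega
    exact ⟨C ⊔ span F {v}, by rw [finrank_sup_span_singleton hv, hC], (le_sup_left : C ≤ _) h1⟩

theorem ncard_div_le_inv_pow {q a b e s t : ℕ} (hq : 0 < q) (h : a * q ^ e ≤ b) (hs : s * t ≤ e) :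
    (a : ℝ) / b ≤ (((q : ℝ) ^ s)⁻¹) ^ t := by
  rcases Nat.eq_zero_or_pos b with rfl | hb
  · simp
  have hb' : (0 : ℝ) < b := by exact_mod_cast hb
  rw [inv_pow, ← pow_mul, div_le_iff₀ hb', inv_mul_eq_div, le_div_iff₀ (by positivity)]
  have : a * q ^ (s * t) ≤ b :=
    (Nat.mul_le_mul_left _ (Nat.pow_le_pow_right hq hs)).trans h
  exact_mod_cast this

variable [Fintype F]

/-- The planted vector comes for free, so a `T` containing it gains only `dim T - 1` factors `q^(-(n
- k))`. Off the exempt line such a `T` has `dim T ≥ 2`, so `dim T - 1 ≥ dim T / 2`; this is the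
origin of the factor 2 in `hs`. -/
theorem isSpread_plantedCodes {n k s : ℕ} (hn : 0 < n) (hk : k ≤ n) (hs : 2 * s ≤ n - k) :
    IsSpread (F := F) (uniformOn (plantedCodes F n k)) id 1 (((Fintype.card F : ℝ) ^ s)⁻¹) := by
  intro T hT
  have hn0 : NeZero n := ⟨by omega⟩
  have h1 : finrank F (span F {(1 : Fin n → F)}) = 1 := finrank_span_singleton one_ne_zero
  have hE : plantedCodes F n k ∩ {C | T ≤ id C} =
      subspacesBetween k (T ⊔ span F {1}) ⊤ := by
    rw [plantedCodes_eq]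
    ext C
    simp only [subspacesBetween, id]
    exact ⟨fun h => ⟨h.1.1, sup_le h.2 h.1.2.1, h.1.2.2⟩,
      fun h => ⟨⟨h.1, le_sup_right.trans h.2.1, h.2.2⟩, le_sup_left.trans h.2.1⟩⟩
  have hle := ncard_subspacesBetween_mul_pow_le (F := F) (d := k) (S := (⊤ : Submodule F (Fin n → F)))
    (by simpa using hk) (le_sup_right : span F {1} ≤ T ⊔ span F {1}) le_top
  rw [uniformOn_real, hE, plantedCodes_eq]
  rw [← pow_mul, h1, finrank_top, finrank_pi, Fintype.card_fin] at hle
  refine ncard_div_le_inv_pow Fintype.card_pos hle ?_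
  by_cases hu : (1 : Fin n → F) ∈ T
  · rw [sup_eq_left.2 ((span_singleton_le_iff_mem _ _).2 hu)]
    have h2 : 2 ≤ finrank F T := by
      by_contra! hlt
      exact hT (Submodule.eq_of_le_of_finrank_le ((span_singleton_le_iff_mem _ _).2 hu)
        (by omega)).symm
    obtain ⟨m, hm⟩ := Nat.exists_eq_add_of_le h2
    rw [hm]
    calc s * (2 + m) ≤ 2 * s * (2 + m - 1) := by
          rw [show 2 + m - 1 = m + 1 by omega]; nlinarith
      _ ≤ _ := Nat.mul_le_mul_right _ hs
  · rw [finrank_sup_span_singleton hu, Nat.add_sub_cancel]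
    exact Nat.mul_le_mul_right _ (by omega)

/-- Duality turns planted codes into the `(n - k)`-dimensional subspaces of the hyperplane
orthogonal to `1`, where they have codimension `k - 1`. A `T` outside the hyperplane is never
contained. -/
theorem isSpread_dualCode_plantedCodes {n k s : ℕ} (hn : 0 < n) (hk : k ≤ n)
    (hs : 2 * s ≤ k - 1) :
    IsSpread (F := F) (uniformOn (plantedCodes F n k)) dualCode 1
      (((Fintype.card F : ℝ) ^ s)⁻¹) := by
  intro T _
  have hn0 : NeZero n := ⟨by omega⟩
  -- For `k = 0` truncated subtraction forces `s = 0`, and the bound is the trivial one.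
  rcases Nat.eq_zero_or_pos k with rfl | hk0
  · have : s = 0 := by omega
    subst this
    simpa [uniformOn_real] using
      div_le_one_of_le₀ (by exact_mod_cast Set.ncard_le_ncard Set.inter_subset_left) (by positivity)
  have h1 : finrank F (dualCode (span F {(1 : Fin n → F)})) = n - 1 := by
    rw [finrank_dualCode, Fintype.card_fin, finrank_span_singleton one_ne_zero]
  have himg : ∀ T : Submodule F (Fin n → F),
      (plantedCodes F n k ∩ {C | T ≤ dualCode C}).ncard =
        (subspacesBetween (n - k) T (dualCode (span F {1}))).ncard := by
    intro T
    rw [← Set.ncard_image_of_injective _ dualCode_injective]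
    congr 1
    ext D
    constructor
    · rintro ⟨C, ⟨⟨hCk, hC1⟩, hCT⟩, rfl⟩
      refine ⟨by rw [finrank_dualCode, hCk, Fintype.card_fin], hCT, ?_⟩
      rw [le_dualCode_comm, dualCode_dualCode]
      exact (span_singleton_le_iff_mem _ _).2 hC1
    · rintro ⟨hDk, hDT, hD1⟩
      refine ⟨dualCode D, ⟨⟨?_, ?_⟩, ?_⟩, dualCode_dualCode D⟩
      · rw [finrank_dualCode, hDk, Fintype.card_fin]; omega
      · exact (span_singleton_le_iff_mem _ _).1 (le_dualCode_comm.1 hD1)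
      · change T ≤ dualCode (dualCode D)
        rwa [dualCode_dualCode]
  have hbot : (plantedCodes F n k).ncard =
      (subspacesBetween (n - k) ⊥ (dualCode (span F {(1 : Fin n → F)}))).ncard := by
    rw [← himg ⊥]
    congr 1
    ext C
    simp
  rw [uniformOn_real, himg, hbot]
  by_cases hT : T ≤ dualCode (span F {1})
  · have hle := ncard_subspacesBetween_mul_pow_le (F := F) (d := n - k)
      (S := dualCode (span F {(1 : Fin n → F)})) (by rw [h1]; omega) bot_le hT
    rw [← pow_mul, h1, finrank_bot] at hle
    exact ncard_div_le_inv_pow Fintype.card_pos hle (Nat.mul_le_mul_right _ (by omega))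
  · have : subspacesBetween (n - k) T (dualCode (span F {(1 : Fin n → F)})) = ∅ :=
      Set.eq_empty_of_forall_notMem fun D hD => hT (hD.2.1.trans hD.2.2)
    rw [this]
    simp only [Set.ncard_empty, Nat.cast_zero, zero_div]
    positivity

end Spread

/-! ### Spread codes are robust with high probability -/

section Robust

open Module Submodule

variable {F : Type*} [Field F]

/-- Union bound over the at most `(q^e)^t` independent `t`-tuples of `E`, each spanning a
`t`-dimensional space. The condition `hu` keeps that span away from the exempt line. -/
theorem IsSpread.measureReal_le_finrank_inf [Fintype F] {V : Type*} [AddCommGroup V] [Module F V]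
    [Finite V] {Ω : Type*} [MeasurableSpace Ω] {μ : Measure Ω} [IsFiniteMeasure μ]
    {D : Ω → Submodule F V} {u : V} {p : ℝ} (hp : 0 ≤ p) (hD : IsSpread μ D u p)
    {E : Submodule F V} {e t : ℕ} (he : finrank F E ≤ e) (hu : 2 ≤ t ∨ u ∉ E) :
    μ.real {ω | t ≤ finrank F ↥(D ω ⊓ E)} ≤ ((Fintype.card F : ℝ) ^ e * p) ^ t := by
  classical
  have := Fintype.ofFinite V
  have hq : (1 : ℝ) ≤ Fintype.card F := by exact_mod_cast Fintype.card_pos (α := F)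
  let G : Finset (Fin t → E) := Finset.univ.filter (fun g => LinearIndependent F g)
  have hG : (G.card : ℝ) ≤ ((Fintype.card F : ℝ) ^ e) ^ t := by
    have h1 : G.card ≤ (Fintype.card F ^ finrank F E) ^ t := by
      refine (Finset.card_le_univ _).trans ?_
      rw [Fintype.card_fun, Fintype.card_fin, Module.card_eq_pow_finrank (K := F) (V := E)]
    refine (Nat.cast_le.2 h1).trans ?_
    push_cast
    gcongr
  have hsub : {ω | t ≤ finrank F ↥(D ω ⊓ E)} ⊆
      ⋃ g ∈ G, {ω | span F (Set.range fun i => (g i : V)) ≤ D ω} := by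
    intro ω hω
    obtain ⟨f, hf⟩ := exists_linearIndependent_of_le_finrank (R := F) hω
    simp only [Set.mem_iUnion]
    refine ⟨fun i => ⟨f i, (f i).2.2⟩, ?_, ?_⟩
    · simp only [G, Finset.mem_filter, Finset.mem_univ, true_and]
      refine LinearIndependent.of_comp E.subtype ?_
      exact hf.map' (D ω ⊓ E).subtype (by simp)
    · refine span_le.2 ?_
      rintro _ ⟨i, rfl⟩
      exact (f i).2.1
  calc μ.real {ω | t ≤ finrank F ↥(D ω ⊓ E)}
      ≤ ∑ g ∈ G, μ.real {ω | span F (Set.range fun i => (g i : V)) ≤ D ω} :=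
        (measureReal_mono hsub (measure_ne_top _ _)).trans (measureReal_biUnion_finset_le _ _)
    _ ≤ ∑ g ∈ G, p ^ t := by
        refine Finset.sum_le_sum fun g hg => ?_
        have hg : LinearIndependent F g := (Finset.mem_filter.1 hg).2
        have hg' : LinearIndependent F fun i => (g i : V) := hg.map' E.subtype (by simp)
        have hfin : finrank F (span F (Set.range fun i => (g i : V))) = t := by
          rw [finrank_span_eq_card hg', Fintype.card_fin]
        refine (hD _ fun h => ?_).trans_eq (by rw [hfin])
        rcases hu with hu | hu
        · have h2 := finrank_span_le_card (R := F) ({u} : Set V)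
          rw [← h, hfin, Set.toFinset_singleton, Finset.card_singleton] at h2
          omega
        · refine hu (span_le.2 ?_ (h ▸ mem_span_singleton_self u : u ∈ span F _))
          rintro _ ⟨i, rfl⟩
          exact (g i).2
    _ = G.card * p ^ t := by rw [Finset.sum_const, nsmul_eq_mul]
    _ ≤ _ := by
        rw [mul_pow]
        gcongr

variable {ι : Type*}

/-- The vectors whose support lies in `A`. -/
def supportedOn (F : Type*) [Field F] {ι : Type*} (A : Finset ι) : Submodule F (ι → F) where
  carrier := {v | ∀ i, i ∉ A → v i = 0}
  add_mem' := fun ha hb i hi => by simp [ha i hi, hb i hi]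
  zero_mem' := fun _ _ => rfl
  smul_mem' := fun c _ ha i hi => by simp [ha i hi]

theorem mem_supportedOn {A : Finset ι} {v : ι → F} :
    v ∈ supportedOn F A ↔ ∀ i, i ∉ A → v i = 0 := Iff.rfl

variable [Fintype ι]

theorem finrank_supportedOn_le (A : Finset ι) : finrank F (supportedOn F A) ≤ A.card := by
  have h := LinearMap.finrank_le_finrank_of_injective
    (f := (LinearMap.funLeft F F ((↑) : A → ι)).comp (supportedOn F A).subtype) (by
      intro v w h
      ext i
      by_cases hi : i ∈ A
      · exact congrFun h ⟨i, hi⟩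
      · rw [mem_supportedOn.1 v.2 i hi, mem_supportedOn.1 w.2 i hi])
  simpa using h

variable [DecidableEq F]

theorem hammingNorm_le_of_mem_supportedOn {A : Finset ι} {v : ι → F} (hv : v ∈ supportedOn F A) :
    hammingNorm v ≤ A.card :=
  Finset.card_le_card fun i hi => by
    by_contra h
    exact (Finset.mem_filter.1 hi).2 (hv i h)

theorem hammingNorm_add_le (v w : ι → F) : hammingNorm (v + w) ≤ hammingNorm v + hammingNorm w := by
  simpa [hammingDist_eq_hammingNorm] using hammingDist_triangle (-v) 0 w

/-- No subspace `V` of dimension at most `m` spanned by vectors of weight at most `w` meets `D` in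
half of its dimension, even after modifying `D` on a set of at most `w` coordinates. -/
def IsRobust (w m : ℕ) (D : Submodule F (ι → F)) : Prop :=
  ∀ A : Finset ι, A.card ≤ w → ∀ S : Set (ι → F), (∀ v ∈ S, hammingNorm v ≤ w) →
    Disjoint (span F S) (supportedOn F A) → 0 < finrank F (span F S) → finrank F (span F S) ≤ m →
      2 * finrank F ↥((D ⊔ supportedOn F A) ⊓ span F S) < finrank F (span F S)

/-- Trades the enlarged code for `D` itself, to which the spread bound applies: modulo vectors
supported on `A`, the large intersection lifts to `D ⊓ (E ⊔ supportedOn F A)`, and disjointness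
prevents any loss of dimension. A basis of size `m` is padded with zeros to length `2 * t`, `t = ⌈m
/ 2⌉`. -/
theorem exists_of_not_isRobust {w t₀ : ℕ} {D : Submodule F (ι → F)}
    (h : ¬ IsRobust w (2 * t₀) D) :
    ∃ t ∈ Finset.Icc 1 t₀, ∃ A : Finset ι, A.card ≤ w ∧ ∃ v : Fin (2 * t) → ι → F,
      (∀ i, hammingNorm (v i) ≤ w) ∧
        t ≤ finrank F ↥(D ⊓ (span F (Set.range v) ⊔ supportedOn F A)) := by
  simp only [IsRobust, not_forall, not_lt] at h
  obtain ⟨A, hA, S, hS, hdisj, hpos, hle, h⟩ := h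
  obtain ⟨m, f, hm, hfS, hfspan⟩ : ∃ m, ∃ f : Fin m → ι → F, finrank F (span F S) = m ∧
      (∀ i, f i ∈ S) ∧ span F (Set.range f) = span F S := by
    obtain ⟨f, hfS, hfspan, -⟩ := exists_fun_fin_finrank_span_eq F S
    exact ⟨_, f, rfl, hfS, hfspan⟩
  rw [hm] at hpos hle h
  refine ⟨(m + 1) / 2, Finset.mem_Icc.2 ⟨by omega, by omega⟩, A, hA,
    fun i => if hi : (i : ℕ) < m then f ⟨i, hi⟩ else 0, ?_, ?_⟩
  · intro i
    dsimp only
    split_ifs with hi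
    · exact hS _ (hfS _)
    · simp
  · set E := span F (Set.range fun i : Fin (2 * ((m + 1) / 2)) =>
      if hi : (i : ℕ) < m then f ⟨i, hi⟩ else 0)
    have hSE : span F S ≤ E := by
      rw [← hfspan]
      refine span_mono ?_
      rintro _ ⟨i, rfl⟩
      exact ⟨⟨i, by have := i.2; omega⟩, by simp⟩
    set X := (D ⊔ supportedOn F A) ⊓ span F S
    have h1 : X ⊔ supportedOn F A ≤ (D ⊓ (E ⊔ supportedOn F A)) ⊔ supportedOn F A := by
      refine sup_le (fun x hx => ?_) le_sup_right
      obtain ⟨d, hd, a, ha, rfl⟩ := mem_sup.1 hx.1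
      refine add_mem_sup ⟨hd, ?_⟩ ha
      have : d = (d + a) + -a := by abel
      rw [this]
      exact add_mem_sup (hSE hx.2) (neg_mem ha)
    have h2 := Submodule.finrank_mono h1
    have h3 := finrank_add_le_finrank_add_finrank (D ⊓ (E ⊔ supportedOn F A)) (supportedOn F A)
    have h4 := finrank_sup_add_finrank_inf_eq X (supportedOn F A)
    rw [(hdisj.mono_left inf_le_right : Disjoint X _).eq_bot, finrank_bot] at h4
    omega

/-- Three vectors of weight at most `w` cannot add up to one of full weight. This settles `t = 1`,
the only case in which the exempt line could interfere. -/
theorem one_notMem_span_sup_supportedOn {w : ℕ} (hw : 3 * w < Fintype.card ι) {A : Finset ι}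
    (hA : A.card ≤ w) {v : Fin (2 * 1) → ι → F} (hv : ∀ i, hammingNorm (v i) ≤ w) :
    (1 : ι → F) ∉ span F (Set.range v) ⊔ supportedOn F A := by
  intro h
  obtain ⟨x, hx, a, ha, hxa⟩ := mem_sup.1 h
  obtain ⟨c, rfl⟩ := (mem_span_range_iff_exists_fun F).1 hx
  have h1 : hammingNorm (1 : ι → F) = Fintype.card ι := by
    simp [hammingNorm]
  have hs : ∀ i, hammingNorm (c i • v i) ≤ w := fun i =>
    (hammingNorm_smul_le_hammingNorm).trans (hv i)
  rw [← hxa, Fin.sum_univ_two] at h1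
  have := hammingNorm_add_le (c 0 • v 0 + c 1 • v 1) a
  have := hammingNorm_add_le (c 0 • v 0) (c 1 • v 1)
  have := hammingNorm_le_of_mem_supportedOn ha
  have := hs 0
  have := hs 1
  omega

/-- The number of vectors of weight at most `w`. -/
def hammingBallCard (F : Type*) [Field F] [Fintype F] [DecidableEq F] (ι : Type*) [Fintype ι]
    [DecidableEq ι] (w : ℕ) : ℕ :=
  (Finset.univ.filter fun v : ι → F => hammingNorm v ≤ w).card

variable [Fintype F] [DecidableEq ι]

theorem hammingBallCard_pos (w : ℕ) : 0 < hammingBallCard F ι w :=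
  Finset.card_pos.2 ⟨0, by simp⟩

theorem card_filter_card_le (w : ℕ) :
    (Finset.univ.filter fun A : Finset ι => A.card ≤ w).card ≤ hammingBallCard F ι w := by
  refine Finset.card_le_card_of_injOn (fun A i => if i ∈ A then (1 : F) else 0) ?_ ?_
  · intro A hA
    have hA : A.card ≤ w := by simpa using hA
    simp only [Finset.coe_filter, Finset.mem_univ, true_and]
    refine (hammingNorm_le_of_mem_supportedOn (A := A) ?_).trans hA
    intro i hi
    simp [hi]
  · intro A _ B _ h
    ext i
    have := congrFun h i
    by_cases hA : i ∈ A <;> by_cases hB : i ∈ B <;> simp_all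

variable {Ω : Type*} [MeasurableSpace Ω] {μ : Measure Ω} [IsFiniteMeasure μ]

/-- With `L` the ball size, a given `t` admits at most `L` sets `A` and `L^(2t)` tuples. Bounding `L
≤ L^t` makes the total a `t`-th power `β^t`, and `β^t ≤ β` since `β ≤ 1`. -/
theorem IsSpread.measureReal_not_isRobust_le {D : Ω → Submodule F (ι → F)} {p : ℝ} (hp : 0 ≤ p)
    (hD : IsSpread μ D 1 p) {w t₀ : ℕ} (hw : 3 * w < Fintype.card ι)
    (hsmall : (hammingBallCard F ι w : ℝ) ^ 3 * ((Fintype.card F : ℝ) ^ (2 * t₀ + w) * p) ≤ 1) :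
    μ.real {ω | ¬ IsRobust w (2 * t₀) (D ω)} ≤
      t₀ * ((hammingBallCard F ι w : ℝ) ^ 3 * ((Fintype.card F : ℝ) ^ (2 * t₀ + w) * p)) := by
  set L := hammingBallCard F ι w
  set q : ℝ := (Fintype.card F : ℝ)
  have hL1 : (1 : ℝ) ≤ L := by exact_mod_cast hammingBallCard_pos w
  let 𝒜 := Finset.univ.filter fun A : Finset ι => A.card ≤ w
  let 𝓑 := Finset.univ.filter fun v : ι → F => hammingNorm v ≤ w
  have hA : (𝒜.card : ℝ) ≤ L := by exact_mod_cast card_filter_card_le w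
  have hsub : {ω | ¬ IsRobust w (2 * t₀) (D ω)} ⊆ ⋃ t ∈ Finset.Icc 1 t₀, ⋃ A ∈ 𝒜,
      ⋃ v ∈ Fintype.piFinset (fun _ : Fin (2 * t) => 𝓑),
        {ω | t ≤ finrank F ↥(D ω ⊓ (span F (Set.range v) ⊔ supportedOn F A))} := by
    intro ω hω
    obtain ⟨t, ht, A, hA, v, hv, h⟩ := exists_of_not_isRobust hω
    simp only [Set.mem_iUnion]
    exact ⟨t, ht, A, by simpa [𝒜] using hA, v, by simpa [𝓑, Fintype.mem_piFinset] using hv, h⟩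
  set β := (L : ℝ) ^ 3 * (q ^ (2 * t₀ + w) * p)
  have hβ : 0 ≤ β := by positivity
  have hterm : ∀ t ∈ Finset.Icc 1 t₀, ∀ A ∈ 𝒜,
      ∀ v ∈ Fintype.piFinset (fun _ : Fin (2 * t) => 𝓑),
      μ.real {ω | t ≤ finrank F ↥(D ω ⊓ (span F (Set.range v) ⊔ supportedOn F A))} ≤
        (q ^ (2 * t₀ + w) * p) ^ t := by
    intro t ht A hA v hv
    have ht := Finset.mem_Icc.1 ht
    have hA : A.card ≤ w := by simpa [𝒜] using hA
    have hv : ∀ i, hammingNorm (v i) ≤ w := by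
      simpa [𝓑, Fintype.mem_piFinset] using hv
    refine hD.measureReal_le_finrank_inf hp ?_ ?_
    · have h1 := finrank_add_le_finrank_add_finrank (span F (Set.range v)) (supportedOn F A)
      have h2 := finrank_supportedOn_le (F := F) A
      have h3 := finrank_range_le_card (R := F) v
      rw [Set.finrank, Fintype.card_fin] at h3
      omega
    · rcases Nat.lt_or_ge t 2 with h | h
      · obtain rfl : t = 1 := by omega
        exact Or.inr (one_notMem_span_sup_supportedOn hw hA hv)
      · exact Or.inl h
  calc μ.real {ω | ¬ IsRobust w (2 * t₀) (D ω)}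
      ≤ ∑ t ∈ Finset.Icc 1 t₀, ∑ A ∈ 𝒜, ∑ v ∈ Fintype.piFinset (fun _ : Fin (2 * t) => 𝓑),
          (q ^ (2 * t₀ + w) * p) ^ t := by
        refine (measureReal_mono hsub (measure_ne_top _ _)).trans ((measureReal_biUnion_finset_le _ _).trans ?_)
        refine Finset.sum_le_sum fun t ht => (measureReal_biUnion_finset_le _ _).trans ?_
        refine Finset.sum_le_sum fun A hA => (measureReal_biUnion_finset_le _ _).trans ?_
        exact Finset.sum_le_sum fun v hv => hterm t ht A hA v hv
    _ ≤ ∑ t ∈ Finset.Icc 1 t₀, β := by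
        refine Finset.sum_le_sum fun t ht => ?_
        have ht := Finset.mem_Icc.1 ht
        rw [Finset.sum_const, Finset.sum_const, Fintype.card_piFinset, Finset.prod_const,
          Finset.card_univ, Fintype.card_fin, nsmul_eq_mul, nsmul_eq_mul]
        push_cast
        calc (𝒜.card : ℝ) * ((L : ℝ) ^ (2 * t) * (q ^ (2 * t₀ + w) * p) ^ t)
            ≤ (L : ℝ) ^ t * ((L : ℝ) ^ (2 * t) * (q ^ (2 * t₀ + w) * p) ^ t) := by
              gcongr
              exact hA.trans (le_self_pow₀ hL1 (by omega))
          _ = β ^ t := by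
              rw [← mul_assoc, ← pow_add, show t + 2 * t = 3 * t by ring, pow_mul, ← mul_pow]
          _ ≤ β := pow_le_of_le_one hβ hsmall (by omega)
    _ = t₀ * β := by rw [Finset.sum_const, Nat.card_Icc, Nat.add_sub_cancel, nsmul_eq_mul]

end Robust

/-! ### Membership of a fixed high-rank matrix -/

section RowSpace

open Module Submodule

variable {F : Type*} [Field F] {ι κ : Type*} [Fintype ι] [Fintype κ]

theorem Submodule.exists_matrix_ker_eq [DecidableEq ι] (E : Submodule F (ι → F)) :
    ∃ P : Matrix ι ι F, LinearMap.ker P.mulVecLin = E := by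
  obtain ⟨E', hE⟩ := E.exists_isCompl
  refine ⟨LinearMap.toMatrix' (E'.subtype ∘ₗ E'.projectionOnto E hE.symm), ?_⟩
  ext v
  rw [LinearMap.mem_ker, Matrix.mulVecLin_apply, LinearMap.toMatrix'_mulVec]
  simp

/-- Take `T` to be the row space of `P * y` with `ker P = E₁`: `P` kills the column-code part,
leaving combinations of rows in `E₂`, and rank–nullity for `P` on `U` bounds `dim T` below. That `T`
is chosen before `E₂` is what allows independence to be used. -/
theorem exists_rowSpace_le [DecidableEq ι] (E₁ : Submodule F (ι → F)) (y : Matrix ι κ F) :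
    ∃ T : Submodule F (κ → F), T ≤ LinearMap.range y.transpose.mulVecLin ∧
      (∀ U ≤ LinearMap.range y.mulVecLin,
        finrank F U ≤ finrank F T + finrank F ↥(E₁ ⊓ U)) ∧
      ∀ E₂ : Submodule F (κ → F), y ∈ tensorCode E₁ ⊤ ⊔ tensorCode ⊤ E₂ → T ≤ E₂ := by
  obtain ⟨P, hP⟩ := E₁.exists_matrix_ker_eq
  refine ⟨LinearMap.range (P * y).transpose.mulVecLin, ?_, ?_, ?_⟩
  · rw [Matrix.transpose_mul, Matrix.mulVecLin_mul]
    exact LinearMap.range_comp_le_range _ _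
  · intro U hU
    have h1 : (U.map P.mulVecLin) ≤ LinearMap.range (P * y).mulVecLin := by
      rw [Matrix.mulVecLin_mul, LinearMap.range_comp]
      exact Submodule.map_mono hU
    have h2 := Submodule.finrank_mono h1
    have h3 : finrank F (LinearMap.range (P * y).transpose.mulVecLin) =
        finrank F (LinearMap.range (P * y).mulVecLin) := Matrix.rank_transpose _
    have h4 := LinearMap.finrank_range_add_finrank_ker (P.mulVecLin.domRestrict U)
    rw [LinearMap.range_domRestrict, LinearMap.ker_domRestrict, hP] at h4
    have h5 : finrank F (E₁.comap U.subtype) = finrank F ↥(E₁ ⊓ U) := by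
      rw [← finrank_map_subtype_eq U, Submodule.map_comap_subtype, inf_comm]
    omega
  · intro E₂ hy
    obtain ⟨c, hc, r, hr, rfl⟩ := mem_sup.1 hy
    have hPc : P * c = 0 := by
      ext i j
      have : (fun i => c i j) ∈ LinearMap.ker P.mulVecLin := by rw [hP]; exact hc.1 j
      exact congrFun (LinearMap.mem_ker.1 this) i
    rw [Matrix.mul_add, hPc, zero_add, Matrix.transpose_mul, Matrix.mulVecLin_mul]
    refine (LinearMap.range_comp_le_range _ _).trans ?_
    rw [Matrix.range_mulVecLin, span_le]
    rintro _ ⟨i, rfl⟩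
    exact hr.2 i

theorem Submodule.exists_le_finrank_eq {V : Type*} [AddCommGroup V] [Module F V]
    {E : Submodule F V} {t : ℕ} (ht : t ≤ finrank F E) : ∃ U ≤ E, finrank F U = t := by
  obtain ⟨f, hf⟩ := exists_linearIndependent_of_le_finrank ht
  refine ⟨span F (Set.range fun i => (f i : V)), span_le.2 ?_, ?_⟩
  · rintro _ ⟨i, rfl⟩
    exact (f i).2
  · have hf' : LinearIndependent F fun i => (f i : V) := hf.map' E.subtype (by simp)
    rw [finrank_span_eq_card hf', Fintype.card_fin]

variable {Ω₁ Ω₂ : Type*} [MeasurableSpace Ω₁] [MeasurableSpace Ω₂]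

theorem measureReal_prod_le_of_forall {μ : Measure Ω₁} {ν : Measure Ω₂} [IsProbabilityMeasure μ]
    [IsProbabilityMeasure ν] {S : Set (Ω₁ × Ω₂)} (hS : MeasurableSet S) {b : ℝ} (hb : 0 ≤ b)
    (h : ∀ ω, ν.real (Prod.mk ω ⁻¹' S) ≤ b) : (μ.prod ν).real S ≤ b := by
  refine ENNReal.toReal_le_of_le_ofReal hb ?_
  rw [Measure.prod_apply hS]
  calc ∫⁻ ω, ν (Prod.mk ω ⁻¹' S) ∂μ ≤ ∫⁻ _, ENNReal.ofReal b ∂μ :=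
        lintegral_mono fun ω => (ENNReal.le_ofReal_iff_toReal_le (measure_ne_top _ _) hb).2 (h ω)
    _ = ENNReal.ofReal b := by simp

/-- Fix a `2 * t₀`-dimensional `U` in the column space. Either `D₁` meets `U` in dimension at least
`t₀`, or, with the first code frozen, `D₂` must contain a fixed `T` of dimension at least `t₀`. -/
theorem IsSpread.measureReal_mem_sup_tensorCode_le [Fintype F] [DiscreteMeasurableSpace (Ω₁ × Ω₂)]
    {μ : Measure Ω₁} {ν : Measure Ω₂} [IsProbabilityMeasure μ] [IsProbabilityMeasure ν]
    {D₁ : Ω₁ → Submodule F (ι → F)} {D₂ : Ω₂ → Submodule F (κ → F)} {u₁ : ι → F} {u₂ : κ → F}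
    {p : ℝ} (hp : 0 ≤ p) (hp1 : p ≤ 1) (hD₁ : IsSpread μ D₁ u₁ p) (hD₂ : IsSpread ν D₂ u₂ p)
    {t₀ : ℕ} (ht₀ : 2 ≤ t₀) {x : Matrix ι κ F} (hx : 2 * t₀ ≤ x.rank) :
    (μ.prod ν).real {ω | x ∈ tensorCode (D₁ ω.1) ⊤ ⊔ tensorCode ⊤ (D₂ ω.2)} ≤
      ((Fintype.card F : ℝ) ^ (2 * t₀) * p) ^ t₀ + p ^ t₀ := by
  classical
  obtain ⟨U, hU, hUfin⟩ := Submodule.exists_le_finrank_eq (E := LinearMap.range x.mulVecLin) hx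
  choose T _ hT hTle using fun E₁ : Submodule F (ι → F) => exists_rowSpace_le E₁ x
  have hsub : {ω : Ω₁ × Ω₂ | x ∈ tensorCode (D₁ ω.1) ⊤ ⊔ tensorCode ⊤ (D₂ ω.2)} ⊆
      ({ω | t₀ ≤ finrank F ↥(D₁ ω ⊓ U)} ×ˢ Set.univ) ∪
        {ω | finrank F ↥(D₁ ω.1 ⊓ U) < t₀ ∧ T (D₁ ω.1) ≤ D₂ ω.2} := by
    intro ω hω
    rcases Nat.lt_or_ge (finrank F ↥(D₁ ω.1 ⊓ U)) t₀ with h | h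
    · exact Or.inr ⟨h, hTle _ _ hω⟩
    · exact Or.inl ⟨h, trivial⟩
  refine (measureReal_mono hsub).trans ((measureReal_union_le _ _).trans (add_le_add ?_ ?_))
  · rw [measureReal_prod_prod, probReal_univ, mul_one]
    exact hD₁.measureReal_le_finrank_inf hp hUfin.le (Or.inl ht₀)
  · refine measureReal_prod_le_of_forall (.of_discrete) (by positivity) fun ω => ?_
    by_cases h : finrank F ↥(D₁ ω ⊓ U) < t₀
    · have h1 := hT (D₁ ω) U hU
      have h2 : t₀ ≤ finrank F (T (D₁ ω)) := by omega
      refine (measureReal_mono (fun ω' hω' => hω'.2)).trans ((hD₂ (T (D₁ ω)) ?_).trans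
        (pow_le_pow_of_le_one hp hp1 h2))
      intro h3
      have h4 := finrank_span_le_card (R := F) ({u₂} : Set (κ → F))
      rw [← h3, Set.toFinset_singleton, Finset.card_singleton] at h4
      omega
    · have : (Prod.mk ω ⁻¹' {ω : Ω₁ × Ω₂ | finrank F ↥(D₁ ω.1 ⊓ U) < t₀ ∧
          T (D₁ ω.1) ≤ D₂ ω.2}) = ∅ := Set.eq_empty_of_forall_notMem fun ω' hω' => h hω'.1
      rw [this, measureReal_empty]
      positivity

end RowSpace

/-! ### Robust codes are product-expanding on sparse low-rank matrices -/

section Deterministic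

open Module Submodule

variable {F : Type*} [Field F] {ι κ : Type*}

theorem matrixWeight_transpose (x : Matrix ι κ F) : matrixWeight x.transpose = matrixWeight x := by
  rw [matrixWeight, matrixWeight, ← Set.ncard_image_of_injective _ Prod.swap_injective]
  congr 1
  ext ⟨i, j⟩
  simp

theorem rowWeight_le_card {A : Finset ι} {x : Matrix ι κ F} (h : ∀ i, i ∉ A → ∀ j, x i j = 0) :
    rowWeight x ≤ A.card := by
  rw [rowWeight, ← Set.ncard_coe_finset]
  refine Set.ncard_le_ncard fun i hi => ?_
  obtain ⟨j, hj⟩ := hi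
  by_contra hA
  exact hj (h i hA j)

theorem colWeight_le_card {B : Finset κ} {x : Matrix ι κ F} (h : ∀ j, j ∉ B → ∀ i, x i j = 0) :
    colWeight x ≤ B.card :=
  rowWeight_le_card (x := x.transpose) h

theorem disjoint_span_col_supportedOn {A : Finset ι} {x : Matrix ι κ F}
    (hx : ∀ i ∈ A, ∀ j, x i j = 0) : Disjoint (span F (Set.range x.col)) (supportedOn F A) := by
  rw [disjoint_def]
  intro v hv hvA
  have : span F (Set.range x.col) ≤ LinearMap.ker (LinearMap.funLeft F F ((↑) : A → ι)) := by
    refine span_le.2 ?_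
    rintro _ ⟨j, rfl⟩
    ext i
    exact hx i i.2 j
  ext i
  by_cases hi : i ∈ A
  · exact congrFun (LinearMap.mem_ker.1 (this hv)) ⟨i, hi⟩
  · exact hvA i hi

theorem Submodule.exists_idempotent_of_disjoint {V : Type*} [AddCommGroup V] [Module F V]
    {D E : Submodule F V} (h : Disjoint D E) :
    ∃ f : V →ₗ[F] V, (∀ v, f v ∈ D) ∧ (∀ v ∈ D, f v = v) ∧ ∀ v ∈ E, f v = 0 := by
  obtain ⟨D', hD', hc⟩ := h.symm.exists_isCompl
  refine ⟨D.subtype ∘ₗ D.projectionOnto D' hc.symm, fun v => by simp, fun v hv => ?_, fun v hv => ?_⟩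
  · simpa using congrArg Subtype.val (Submodule.projectionOnto_apply_left hc.symm ⟨v, hv⟩)
  · simp [hD' hv]

variable [Fintype κ]

/-- Project the rows of `c` onto `D₂` along a complement containing the vectors supported on `B`,
and move the result `z` from `c` to `r`. A row of `x` outside `A` is supported on `B`, so its
projection vanishes and `r + z` is zero there. Hence a column of `c - z` outside `B` is a vector of
`D₁` supported on `A`, which is zero. -/
theorem exists_decomposition_supported {D₁ : Submodule F (ι → F)} {D₂ : Submodule F (κ → F)}
    {A : Finset ι} {B : Finset κ} (hA : Disjoint D₁ (supportedOn F A))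
    (hB : Disjoint D₂ (supportedOn F B)) {x : Matrix ι κ F}
    (hx : x ∈ tensorCode D₁ ⊤ ⊔ tensorCode ⊤ D₂) (hzero : ∀ i, i ∉ A → ∀ j, j ∉ B → x i j = 0) :
    ∃ c ∈ tensorCode D₁ (⊤ : Submodule F (κ → F)), ∃ r ∈ tensorCode (⊤ : Submodule F (ι → F)) D₂,
      x = c + r ∧ (∀ j, j ∉ B → ∀ i, c i j = 0) ∧ ∀ i, i ∉ A → ∀ j, r i j = 0 := by
  classical
  obtain ⟨c, hc, r, hr, rfl⟩ := mem_sup.1 hx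
  obtain ⟨f, hfD, hfid, hf0⟩ := Submodule.exists_idempotent_of_disjoint hB
  let z : Matrix ι κ F := fun i => f (c i)
  have hz : ∀ i j, z i j = ∑ k, LinearMap.toMatrix' f j k * c i k := by
    intro i j
    have := congrFun (LinearMap.toMatrix'_mulVec f (c i)) j
    exact this.symm
  have hzc : ∀ j, (fun i => z i j) ∈ D₁ := by
    intro j
    have : (fun i => z i j) = ∑ k, LinearMap.toMatrix' f j k • fun i => c i k := by
      ext i
      simp [hz]
    rw [this]
    exact sum_mem fun k _ => D₁.smul_mem _ (hc.1 k)
  have hrz : ∀ i, i ∉ A → ∀ j, (r + z) i j = 0 := by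
    intro i hi j
    have h1 : c i + r i ∈ supportedOn F B := fun j hj => hzero i hi j hj
    have h2 := hf0 _ h1
    rw [map_add, hfid (r i) (hr.2 i), add_comm] at h2
    exact congrFun h2 j
  refine ⟨c - z, ⟨fun j => D₁.sub_mem (hc.1 j) (hzc j), fun _ => mem_top⟩, r + z,
    ⟨fun _ => mem_top, fun i => D₂.add_mem (hr.2 i) (hfD _)⟩, by abel, ?_, hrz⟩
  intro j hj i
  have h3 : (fun i => (c - z) i j) ∈ supportedOn F A := by
    intro i hi
    have h4 := hzero i hi j hj
    have h5 := hrz i hi j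
    simp only [Matrix.add_apply, Matrix.sub_apply] at h4 h5 ⊢
    linear_combination h4 - h5
  exact congrFun (disjoint_def.1 hA _ (D₁.sub_mem (hc.1 j) (hzc j)) h3) i

variable [DecidableEq F] [Fintype ι]

theorem matrixWeight_eq_sum (x : Matrix ι κ F) : matrixWeight x = ∑ i, hammingNorm (x i) := by
  classical
  rw [matrixWeight, Set.ncard_eq_toFinset_card', Set.toFinset_ofPred, Finset.card_filter,
    Fintype.sum_prod_type]
  simp only [hammingNorm, Finset.card_filter]

/-- The rows of weight larger than `w`. -/
def heavyRows (w : ℕ) (x : Matrix ι κ F) : Finset ι := Finset.univ.filter fun i => w < hammingNorm (x i)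

theorem card_heavyRows_mul_le (w : ℕ) (x : Matrix ι κ F) :
    (heavyRows w x).card * (w + 1) ≤ matrixWeight x := by
  rw [matrixWeight_eq_sum, ← smul_eq_mul]
  refine (Finset.card_nsmul_le_sum _ _ _ fun i hi => ?_).trans
    (Finset.sum_le_sum_of_subset (Finset.subset_univ (heavyRows w x)))
  exact (Finset.mem_filter.1 hi).2

/-- Robustness for a line and the empty coordinate set says that `D` has minimum distance above `w`.
-/
theorem IsRobust.disjoint_supportedOn {w m : ℕ} (hm : 0 < m) {D : Submodule F (ι → F)}
    (hD : IsRobust w m D) {A : Finset ι} (hA : A.card ≤ w) : Disjoint D (supportedOn F A) := by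
  rw [disjoint_def]
  intro v hv hvA
  by_contra h0
  have h1 : finrank F (span F {v}) = 1 := finrank_span_singleton h0
  have h := hD ∅ (by simp) {v}
    (by rintro _ rfl; exact (hammingNorm_le_of_mem_supportedOn hvA).trans hA)
    (by
      have : supportedOn F (∅ : Finset ι) = ⊥ :=
        eq_bot_iff.2 fun x hx => funext fun i => hx i (by simp)
      rw [this]
      exact disjoint_bot_right)
    (by omega) (by omega)
  rw [inf_eq_right.2 ((span_singleton_le_iff_mem _ _).2 (le_sup_left (a := D) hv))] at h
  omega

/-- With `U` the whole column space, the rank of `y` is at most the sum of the dimensions in which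
its column and row spaces meet the enlarged codes. For nonzero `y` robustness makes both less than
half the rank. -/
theorem eq_zero_of_isRobust [DecidableEq ι] {w m : ℕ} {D₁ : Submodule F (ι → F)} {D₂ : Submodule F (κ → F)}
    (h₁ : IsRobust w m D₁) (h₂ : IsRobust w m D₂) {A : Finset ι} {B : Finset κ}
    (hA : A.card ≤ w) (hB : B.card ≤ w) {y : Matrix ι κ F}
    (hy : y ∈ tensorCode (D₁ ⊔ supportedOn F A) ⊤ ⊔ tensorCode ⊤ (D₂ ⊔ supportedOn F B))
    (hrow : ∀ i, hammingNorm (y i) ≤ w) (hcol : ∀ j, hammingNorm (y.transpose j) ≤ w)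
    (hyA : ∀ i ∈ A, ∀ j, y i j = 0) (hyB : ∀ j ∈ B, ∀ i, y i j = 0) (hrank : y.rank ≤ m) :
    y = 0 := by
  by_contra hne
  have hpos : 0 < y.rank := by
    rw [Nat.pos_iff_ne_zero]
    intro h
    rw [Matrix.rank, finrank_eq_zero, LinearMap.range_eq_bot] at h
    refine hne ?_
    ext i j
    classical
    simpa using congrFun (LinearMap.congr_fun h (Pi.single j 1)) i
  obtain ⟨T, hTV, hT, hTle⟩ := exists_rowSpace_le (D₁ ⊔ supportedOn F A) y
  have hTD := hTle _ hy
  have hU := hT _ le_rfl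
  have hr : finrank F (LinearMap.range y.transpose.mulVecLin) = y.rank := Matrix.rank_transpose y
  have hr' : finrank F (LinearMap.range y.mulVecLin) = y.rank := rfl
  rw [Matrix.range_mulVecLin] at hr hr' hTV hU
  have a1 := h₁ A hA (Set.range y.col) (by rintro _ ⟨j, rfl⟩; exact hcol j) (disjoint_span_col_supportedOn hyA)
    (by omega) (by omega)
  have a2 := h₂ B hB (Set.range y.transpose.col) (by rintro _ ⟨i, rfl⟩; exact hrow i)
    (disjoint_span_col_supportedOn (x := y.transpose) hyB) (by omega) (by omega)
  have a3 := Submodule.finrank_mono (le_inf hTD hTV)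
  omega

theorem exists_decomposition_of_isRobust [DecidableEq ι] [DecidableEq κ] {w m : ℕ} (hm : 0 < m)
    {D₁ : Submodule F (ι → F)} {D₂ : Submodule F (κ → F)}
    (h₁ : IsRobust w m D₁) (h₂ : IsRobust w m D₂) {x : Matrix ι κ F}
    (hx : x ∈ tensorCode D₁ ⊤ ⊔ tensorCode ⊤ D₂) (hrank : x.rank ≤ m)
    (hA : (heavyRows w x).card ≤ w) (hB : (heavyRows w x.transpose).card ≤ w) :
    ∃ c ∈ tensorCode D₁ (⊤ : Submodule F (κ → F)), ∃ r ∈ tensorCode (⊤ : Submodule F (ι → F)) D₂,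
      x = c + r ∧ colWeight c ≤ (heavyRows w x.transpose).card ∧
        rowWeight r ≤ (heavyRows w x).card := by
  set A := heavyRows w x
  set B := heavyRows w x.transpose
  have hA' : ∀ i, i ∉ A → hammingNorm (x i) ≤ w := fun i hi => by simpa [A, heavyRows] using hi
  have hB' : ∀ j, j ∉ B → hammingNorm (x.transpose j) ≤ w :=
    fun j hj => by simpa [B, heavyRows] using hj
  let y : Matrix ι κ F := fun i j => if i ∈ A ∨ j ∈ B then 0 else x i j
  have hysub : y = Matrix.diagonal (fun i => if i ∈ A then (0 : F) else 1) * x *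
      Matrix.diagonal (fun j => if j ∈ B then (0 : F) else 1) := by
    ext i j
    rw [Matrix.mul_diagonal, Matrix.diagonal_mul]
    by_cases hi : i ∈ A <;> by_cases hj : j ∈ B <;> simp [y, hi, hj]
  have hy0 : y = 0 := by
    refine eq_zero_of_isRobust h₁ h₂ hA hB ?_ ?_ ?_ (fun i hi j => by simp [y, hi])
      (fun j hj i => by simp [y, hj]) ?_
    · obtain ⟨c, hc, r, hr, rfl⟩ := mem_sup.1 hx
      -- Erasing heavy rows alters columns only inside `A`, so it is charged to `c`; erasing the
      -- rest of the heavy columns alters rows only inside `B` and is charged to `r`.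
      have hy : y = (fun i j => c i j + if i ∈ A then -(c i j + r i j) else 0) +
          (fun i j => r i j + if i ∉ A ∧ j ∈ B then -(c i j + r i j) else 0) := by
        ext i j
        by_cases hi : i ∈ A <;> by_cases hj : j ∈ B <;> simp [y, hi, hj]
      rw [hy]
      refine add_mem_sup ⟨fun j => ?_, fun _ => mem_top⟩ ⟨fun _ => mem_top, fun i => ?_⟩
      · exact add_mem_sup (hc.1 j) fun i hi => by simp [hi]
      · exact add_mem_sup (hr.2 i) fun j hj => by simp [hj]
    · intro i
      by_cases hi : i ∈ A
      · have : y i = 0 := by ext j; simp [y, hi]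
        simp [this]
      · refine le_trans (Finset.card_le_card fun j hj => ?_) (hA' i hi)
        simp only [Finset.mem_filter, Finset.mem_univ, true_and] at hj ⊢
        exact fun h => hj (by simp [y, h])
    · intro j
      by_cases hj : j ∈ B
      · have : y.transpose j = 0 := by ext i; rw [Matrix.transpose_apply]; simp [y, hj]
        simp [this]
      · refine le_trans (Finset.card_le_card fun i hi => ?_) (hB' j hj)
        simp only [Finset.mem_filter, Finset.mem_univ, true_and] at hi ⊢
        exact fun h => hi (by rw [Matrix.transpose_apply] at h ⊢; simp [y, h])
    · rw [hysub]
      exact (Matrix.rank_mul_le_left _ _).trans ((Matrix.rank_mul_le_right _ _).trans hrank)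
  obtain ⟨c, hc, r, hr, hcr, hc0, hr0⟩ := exists_decomposition_supported
    (h₁.disjoint_supportedOn hm hA) (h₂.disjoint_supportedOn hm hB) hx fun i hi j hj => by
      have : y i j = x i j := by simp [y, hi, hj]
      rw [← this, hy0, Matrix.zero_apply]
  exact ⟨c, hc, r, hr, hcr, colWeight_le_card hc0, rowWeight_le_card hr0⟩

/-- Above weight `M` the crude bound `n + n` on line counts suffices. Otherwise each heavy line has
at least `w + 1` nonzero entries, so `hM` allows at most `w` of them in each direction, and the same
count gives the expansion inequality. -/
theorem isProductExpanding_of_isRobust {n w m M : ℕ} (hm : 0 < m) {D₁ D₂ : Submodule F (Fin n → F)}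
    (h₁ : IsRobust w m D₁) (h₂ : IsRobust w m D₂)
    (hrank : ∀ x ∈ tensorCode D₁ ⊤ ⊔ tensorCode ⊤ D₂, matrixWeight x ≤ M → x.rank ≤ m)
    (hM : M < (w + 1) * (w + 1)) {ρ : ℝ} (hρ : 0 ≤ ρ) (hρM : ρ * n * (n + n) ≤ M + 1)
    (hρw : ρ * n * 2 ≤ w + 1) : IsProductExpanding ρ D₁ D₂ := by
  intro x hx
  rcases Nat.lt_or_ge M (matrixWeight x) with hxM | hxM
  · obtain ⟨c, hc, r, hr, rfl⟩ := mem_sup.1 hx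
    refine ⟨c, hc, r, hr, rfl, ?_⟩
    have h1 : colWeight c ≤ n := by
      simpa using colWeight_le_card (B := Finset.univ) (x := c) (by simp)
    have h2 : rowWeight r ≤ n := by
      simpa using rowWeight_le_card (A := Finset.univ) (x := r) (by simp)
    calc ρ * n * (colWeight c + rowWeight r) ≤ ρ * n * (n + n) := by gcongr
      _ ≤ M + 1 := hρM
      _ ≤ _ := by exact_mod_cast hxM
  · have hA := card_heavyRows_mul_le w x
    have hB := card_heavyRows_mul_le w x.transpose
    rw [matrixWeight_transpose] at hB
    have hA' : (heavyRows w x).card ≤ w := by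
      by_contra! h
      exact ((Nat.mul_le_mul_right (w + 1) h).trans (hA.trans hxM)).not_gt hM
    have hB' : (heavyRows w x.transpose).card ≤ w := by
      by_contra! h
      exact ((Nat.mul_le_mul_right (w + 1) h).trans (hB.trans hxM)).not_gt hM
    obtain ⟨c, hc, r, hr, hcr, hcw, hrw⟩ :=
      exists_decomposition_of_isRobust hm h₁ h₂ hx (hrank x hx hxM) hA' hB'
    refine ⟨c, hc, r, hr, hcr, ?_⟩
    have hsum : 0 ≤ (colWeight c : ℝ) + rowWeight r := by positivity
    have h1 : (colWeight c : ℝ) * (w + 1) ≤ matrixWeight x := by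
      exact_mod_cast (Nat.mul_le_mul_right _ hcw).trans hB
    have h2 : (rowWeight r : ℝ) * (w + 1) ≤ matrixWeight x := by
      exact_mod_cast (Nat.mul_le_mul_right _ hrw).trans hA
    nlinarith [mul_le_mul_of_nonneg_right hρw hsum]

end Deterministic

/-! ### Union bound for the failure of expansion, and volumes of Hamming balls -/

section Probability

open Module Submodule

variable {F : Type*} [Field F] [Fintype F] [DecidableEq F]

theorem card_filter_matrixWeight_le (ι κ : Type*) [Fintype ι] [Fintype κ] [DecidableEq ι]
    [DecidableEq κ] (M : ℕ) :
    (Finset.univ.filter fun x : Matrix ι κ F => matrixWeight x ≤ M).card ≤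
      hammingBallCard F (ι × κ) M := by
  refine Finset.card_le_card_of_injOn (fun x p => x p.1 p.2) ?_ ?_
  · intro x hx
    have hx : matrixWeight x ≤ M := by simpa using hx
    rw [matrixWeight, Set.ncard_eq_toFinset_card', Set.toFinset_ofPred] at hx
    simpa [hammingNorm] using hx
  · intro x _ y _ h
    ext i j
    exact congrFun h (i, j)

theorem IsSpread.measureReal_not_isProductExpanding_le {Ω₁ Ω₂ : Type*} [MeasurableSpace Ω₁]
    [MeasurableSpace Ω₂] [DiscreteMeasurableSpace (Ω₁ × Ω₂)]
    {μ : Measure Ω₁} {ν : Measure Ω₂} [IsProbabilityMeasure μ] [IsProbabilityMeasure ν] {n : ℕ}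
    {D₁ : Ω₁ → Submodule F (Fin n → F)} {D₂ : Ω₂ → Submodule F (Fin n → F)}
    {p : ℝ} (hp : 0 ≤ p) (hp1 : p ≤ 1) (hD₁ : IsSpread μ D₁ 1 p) (hD₂ : IsSpread ν D₂ 1 p)
    {t₀ w M : ℕ} (ht₀ : 2 ≤ t₀) (hw : 3 * w < n)
    (hsmall : (hammingBallCard F (Fin n) w : ℝ) ^ 3 *
      ((Fintype.card F : ℝ) ^ (2 * t₀ + w) * p) ≤ 1)
    (hM : M < (w + 1) * (w + 1)) {ρ : ℝ} (hρ : 0 ≤ ρ) (hρM : ρ * n * (n + n) ≤ M + 1)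
    (hρw : ρ * n * 2 ≤ w + 1) :
    (μ.prod ν).real {ω | ¬ IsProductExpanding ρ (D₁ ω.1) (D₂ ω.2)} ≤
      2 * (t₀ * ((hammingBallCard F (Fin n) w : ℝ) ^ 3 *
        ((Fintype.card F : ℝ) ^ (2 * t₀ + w) * p))) +
      hammingBallCard F (Fin n × Fin n) M *
        (((Fintype.card F : ℝ) ^ (2 * t₀) * p) ^ t₀ + p ^ t₀) := by
  classical
  set β := (hammingBallCard F (Fin n) w : ℝ) ^ 3 * ((Fintype.card F : ℝ) ^ (2 * t₀ + w) * p)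
  let 𝒳 : Finset (Matrix (Fin n) (Fin n) F) :=
    Finset.univ.filter fun x => matrixWeight x ≤ M ∧ 2 * t₀ ≤ x.rank
  have h𝒳 : (𝒳.card : ℝ) ≤ hammingBallCard F (Fin n × Fin n) M := by
    refine Nat.cast_le.2 (le_trans (Finset.card_le_card fun x hx => ?_)
      (card_filter_matrixWeight_le (Fin n) (Fin n) M))
    exact Finset.mem_filter.2 ⟨Finset.mem_univ _, (Finset.mem_filter.1 hx).2.1⟩
  have hsub : {ω : Ω₁ × Ω₂ | ¬ IsProductExpanding ρ (D₁ ω.1) (D₂ ω.2)} ⊆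
      (({ω | ¬ IsRobust w (2 * t₀) (D₁ ω)} ×ˢ Set.univ) ∪
        (Set.univ ×ˢ {ω | ¬ IsRobust w (2 * t₀) (D₂ ω)})) ∪
      ⋃ x ∈ 𝒳, {ω | x ∈ tensorCode (D₁ ω.1) ⊤ ⊔ tensorCode ⊤ (D₂ ω.2)} := by
    intro ω hω
    by_contra hcon
    simp only [Set.mem_union, not_or, Set.mem_prod, Set.mem_univ, and_true, true_and,
      Set.mem_iUnion, not_exists] at hcon
    obtain ⟨⟨h1, h2⟩, h3⟩ := hcon
    refine hω (isProductExpanding_of_isRobust (m := 2 * t₀) (by omega) (not_not.1 h1)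
      (not_not.1 h2) (fun x hx hxM => ?_) hM hρ hρM hρw)
    by_contra! hlt
    exact h3 x (Finset.mem_filter.2 ⟨Finset.mem_univ _, hxM, hlt.le⟩) hx
  have hw' : 3 * w < Fintype.card (Fin n) := by simpa using hw
  refine (measureReal_mono hsub).trans ((measureReal_union_le _ _).trans (add_le_add ?_ ?_))
  · refine (measureReal_union_le _ _).trans ?_
    rw [measureReal_prod_prod, measureReal_prod_prod, probReal_univ, probReal_univ, mul_one,
      one_mul, two_mul (_ * β)]
    exact add_le_add (hD₁.measureReal_not_isRobust_le hp hw' hsmall)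
      (hD₂.measureReal_not_isRobust_le hp hw' hsmall)
  · refine (measureReal_biUnion_finset_le _ _).trans ?_
    calc _ ≤ ∑ x ∈ 𝒳, (((Fintype.card F : ℝ) ^ (2 * t₀) * p) ^ t₀ + p ^ t₀) :=
          Finset.sum_le_sum fun x hx => hD₁.measureReal_mem_sup_tensorCode_le hp hp1 hD₂ ht₀
            (Finset.mem_filter.1 hx).2.2
      _ ≤ _ := by
          rw [Finset.sum_const, nsmul_eq_mul]
          gcongr

-- Chernoff-style: the weight enumerator `∑ z ^ |v|` of the full space factors over coordinates.
variable (F) in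
theorem hammingBallCard_mul_pow_le (ι : Type*) [Fintype ι] [DecidableEq ι] {z : ℝ} (hz : 0 ≤ z)
    (hz1 : z ≤ 1) (w : ℕ) :
    hammingBallCard F ι w * z ^ w ≤ (1 + (Fintype.card F - 1) * z) ^ Fintype.card ι := by
  have h1 : ∑ a : F, (if a = 0 then 1 else z) = 1 + (Fintype.card F - 1) * z := by
    rw [← Finset.add_sum_erase _ _ (Finset.mem_univ (0 : F)), if_pos rfl,
      Finset.sum_congr rfl (g := fun _ => z) fun a ha => if_neg (Finset.ne_of_mem_erase ha),
      Finset.sum_const, Finset.card_erase_of_mem (Finset.mem_univ _), Finset.card_univ,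
      nsmul_eq_mul, Nat.cast_pred Fintype.card_pos]
  have h2 : ∀ v : ι → F, ∏ i, (if v i = 0 then 1 else z) = z ^ hammingNorm v := by
    intro v
    rw [Finset.prod_ite, Finset.prod_const_one, one_mul, Finset.prod_const]
    rfl
  calc (hammingBallCard F ι w : ℝ) * z ^ w
      = ∑ v ∈ Finset.univ.filter fun v : ι → F => hammingNorm v ≤ w, z ^ w := by
        rw [Finset.sum_const, nsmul_eq_mul, hammingBallCard]
    _ ≤ ∑ v ∈ Finset.univ.filter fun v : ι → F => hammingNorm v ≤ w, z ^ hammingNorm v :=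
        Finset.sum_le_sum fun v hv => pow_le_pow_of_le_one hz hz1 (Finset.mem_filter.1 hv).2
    _ ≤ ∑ v : ι → F, z ^ hammingNorm v :=
        Finset.sum_le_sum_of_subset_of_nonneg (Finset.subset_univ _) fun _ _ _ => by positivity
    _ = (1 + (Fintype.card F - 1) * z) ^ Fintype.card ι := by
        rw [← h1, ← Finset.card_univ, ← Finset.prod_const, Finset.prod_univ_sum]
        simp only [h2, Fintype.piFinset_univ]

variable (F) in
theorem exists_hammingBallCard_le_pow {B : ℝ} (hB : 1 < B) :
    ∃ α : ℝ, 0 < α ∧ ∀ (ι : Type) [Fintype ι] [DecidableEq ι] (w : ℕ),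
      w ≤ α * Fintype.card ι → (hammingBallCard F ι w : ℝ) ≤ B ^ Fintype.card ι := by
  have hq : (1 : ℝ) < Fintype.card F := by exact_mod_cast Fintype.one_lt_card (α := F)
  -- One factor `b ^ N` pays for the weight enumerator, the other for `z ^ (-w)`.
  set b := √B
  have hb : 1 < b := Real.lt_sqrt_of_sq_lt (by simpa using hB)
  have hbb : b * b = B := Real.mul_self_sqrt (by linarith)
  obtain ⟨z, hz0, hz1, hzb⟩ : ∃ z : ℝ, 0 < z ∧ z < 1 ∧ 1 + (Fintype.card F - 1) * z ≤ b := by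
    refine ⟨min (1 / 2) ((b - 1) / (Fintype.card F - 1)), lt_min (by norm_num)
      (div_pos (by linarith) (by linarith)), (min_le_left _ _).trans_lt (by norm_num), ?_⟩
    have := mul_le_mul_of_nonneg_left
      (min_le_right (1 / 2) ((b - 1) / ((Fintype.card F : ℝ) - 1)))
      (by linarith : 0 ≤ (Fintype.card F : ℝ) - 1)
    rw [mul_div_cancel₀ _ (by linarith)] at this
    linarith
  have hlogz : Real.log z < 0 := Real.log_neg hz0 hz1
  have hlogb : 0 < Real.log b := Real.log_pos hb
  refine ⟨Real.log b / -Real.log z, div_pos hlogb (by linarith), fun ι _ _ w hw => ?_⟩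
  set N := Fintype.card ι
  have h1 : (b ^ N)⁻¹ ≤ z ^ w := by
    rw [← Real.log_le_log_iff (by positivity) (by positivity), Real.log_inv, Real.log_pow,
      Real.log_pow]
    have := mul_le_mul_of_nonneg_right hw (by linarith : 0 ≤ -Real.log z)
    have h : Real.log b / -Real.log z * N * -Real.log z = N * Real.log b := by
      have hne := hlogz.ne
      field_simp
    rw [h] at this
    linarith
  have h2 := hammingBallCard_mul_pow_le F ι hz0.le hz1.le w
  have h3 : (1 + (Fintype.card F - 1) * z) ^ N ≤ b ^ N :=
    pow_le_pow_left₀ (by nlinarith) hzb _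
  have h4 : (hammingBallCard F ι w : ℝ) * (b ^ N)⁻¹ ≤ b ^ N :=
    (mul_le_mul_of_nonneg_left h1 (by positivity)).trans (h2.trans h3)
  rw [← div_eq_mul_inv, div_le_iff₀ (by positivity), ← mul_pow, hbb] at h4
  exact h4

end Probability

/-! ### Choice of constants -/

section Asymptotics

variable {F : Type*} [Field F] [Fintype F]

theorem exists_expansion_parameters [DecidableEq F] {ε : ℝ} (hε : 0 < ε) (hε1 : ε < 1) :
    ∃ ρ : ℝ, 0 < ρ ∧ ∃ δ : ℕ → ℝ, Tendsto δ atTop (𝓝 0) ∧ ∀ n s : ℕ, 128 ≤ ε * n →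
      ε * n / 4 ≤ s → ∃ t₀ w M : ℕ, 2 ≤ t₀ ∧ 3 * w < n ∧ M < (w + 1) * (w + 1) ∧
        ρ * n * (n + n) ≤ M + 1 ∧ ρ * n * 2 ≤ w + 1 ∧
        (hammingBallCard F (Fin n) w : ℝ) ^ 3 *
          ((Fintype.card F : ℝ) ^ (2 * t₀ + w) * ((Fintype.card F : ℝ) ^ s)⁻¹) ≤ 1 ∧
        2 * (t₀ * ((hammingBallCard F (Fin n) w : ℝ) ^ 3 *
          ((Fintype.card F : ℝ) ^ (2 * t₀ + w) * ((Fintype.card F : ℝ) ^ s)⁻¹))) +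
        hammingBallCard F (Fin n × Fin n) M *
          (((Fintype.card F : ℝ) ^ (2 * t₀) * ((Fintype.card F : ℝ) ^ s)⁻¹) ^ t₀ +
            (((Fintype.card F : ℝ) ^ s)⁻¹) ^ t₀) ≤ δ n := by
  have hq : (1 : ℝ) < Fintype.card F := by exact_mod_cast Fintype.one_lt_card (α := F)
  set q : ℝ := (Fintype.card F : ℝ)
  have hq0 : 0 < q := by linarith
  -- The ball enters cubed, contributing `ε * n / 16` to an exponent dominated by `-s ≤ -ε * n / 4`.
  obtain ⟨α₁, hα₁, hL⟩ := exists_hammingBallCard_le_pow F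
    (Real.one_lt_rpow hq (by positivity : 0 < ε / 48))
  -- Membership of a high-rank matrix has exponent `-(3 * ε / 16) * n * t₀ ≤ -3 * ε² * n² / 1024`;
  -- counting sparse matrices uses up a third of it.
  obtain ⟨α₂, hα₂, hX⟩ := exists_hammingBallCard_le_pow F
    (Real.one_lt_rpow hq (by positivity : 0 < ε ^ 2 / 1024))
  -- The cap `ε / 16` keeps `w` small against `s`; below, `η ≤ α ^ 2` yields `M < (w + 1) * (w +
  -- 1)`.
  set α := min α₁ (ε / 16)
  have hα : 0 < α := lt_min hα₁ (by positivity)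
  set η := min α₂ (α ^ 2)
  have hη : 0 < η := lt_min hα₂ (by positivity)
  have hr₁ : q ^ (-(ε / 16)) < 1 := Real.rpow_lt_one_of_one_lt_of_neg hq (by linarith)
  have hr₂ : q ^ (-(ε ^ 2 / 512)) < 1 :=
    Real.rpow_lt_one_of_one_lt_of_neg hq (by have : 0 < ε ^ 2 := by positivity
                                             linarith)
  refine ⟨min η α / 2, half_pos (lt_min hη hα),
    fun n => 2 * (n * (q ^ (-(ε / 16))) ^ n) + 2 * (q ^ (-(ε ^ 2 / 512))) ^ n, ?_, ?_⟩
  · have h1 := (tendsto_self_mul_const_pow_of_lt_one (by positivity) hr₁).const_mul 2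
    have h2 := (tendsto_pow_atTop_nhds_zero_of_lt_one (by positivity) hr₂).const_mul 2
    simpa using h1.add h2
  intro n s hn hs
  have hn1 : (1 : ℝ) ≤ n := by nlinarith
  have hn0 : (0 : ℝ) ≤ n := by linarith
  set t₀ := ⌈ε * n / 64⌉₊
  set w := ⌊α * n⌋₊
  set M := ⌊η * (n * n)⌋₊
  have ht₀l : ε * n / 64 ≤ t₀ := Nat.le_ceil _
  have ht₀u : (t₀ : ℝ) < ε * n / 64 + 1 := Nat.ceil_lt_add_one (by positivity)
  have hwu : (w : ℝ) ≤ α * n := Nat.floor_le (by positivity)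
  have hwl : α * n < w + 1 := Nat.lt_floor_add_one _
  have hMu : (M : ℝ) ≤ η * (n * n) := Nat.floor_le (by positivity)
  have hMl : η * (n * n) < M + 1 := Nat.lt_floor_add_one _
  have hαε : α * n ≤ ε / 16 * n := mul_le_mul_of_nonneg_right (min_le_right _ _) hn0
  have ht₀n : (t₀ : ℝ) ≤ n := by nlinarith
  have hLn : (hammingBallCard F (Fin n) w : ℝ) ≤ q ^ (ε / 48 * n) := by
    have := hL (Fin n) w (hwu.trans (by
      rw [Fintype.card_fin]
      exact mul_le_mul_of_nonneg_right (min_le_left _ _) hn0))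
    rwa [Fintype.card_fin, ← Real.rpow_mul_natCast hq0.le] at this
  have hXn : (hammingBallCard F (Fin n × Fin n) M : ℝ) ≤ q ^ (ε ^ 2 / 1024 * (n * n)) := by
    have := hX (Fin n × Fin n) M (hMu.trans (by
      rw [Fintype.card_prod, Fintype.card_fin]
      push_cast
      exact mul_le_mul_of_nonneg_right (min_le_left _ _) (by positivity)))
    rwa [Fintype.card_prod, Fintype.card_fin, ← Real.rpow_mul_natCast hq0.le, Nat.cast_mul] at this
  set β := (hammingBallCard F (Fin n) w : ℝ) ^ 3 * (q ^ (2 * t₀ + w) * (q ^ s)⁻¹)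
  have hβ : β ≤ (q ^ (-(ε / 16))) ^ n := by
    calc β ≤ (q ^ (ε / 48 * n)) ^ 3 * (q ^ (2 * t₀ + w) * (q ^ s)⁻¹) :=
          mul_le_mul_of_nonneg_right (pow_le_pow_left₀ (by positivity) hLn 3) (by positivity)
      _ = q ^ (ε / 16 * n + (2 * t₀ + w - s)) := by
          rw [← Real.rpow_mul_natCast hq0.le, ← Real.rpow_natCast q (2 * t₀ + w),
            ← Real.rpow_natCast q s, ← Real.rpow_neg hq0.le, ← Real.rpow_add hq0,
            ← Real.rpow_add hq0]
          congr 1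
          push_cast
          ring
      _ ≤ q ^ (-(ε / 16) * n) := Real.rpow_le_rpow_of_exponent_le hq.le (by linarith)
      _ = _ := Real.rpow_mul_natCast hq0.le _ _
  have hβ0 : 0 ≤ β := by positivity
  have hA : q ^ (2 * t₀) * (q ^ s)⁻¹ ≤ q ^ (-(3 * ε / 16) * n) := by
    rw [← Real.rpow_natCast q (2 * t₀), ← Real.rpow_natCast q s, ← Real.rpow_neg hq0.le,
      ← Real.rpow_add hq0]
    refine Real.rpow_le_rpow_of_exponent_le hq.le ?_
    push_cast
    linarith
  have hB : (q ^ s)⁻¹ ≤ q ^ (2 * t₀) * (q ^ s)⁻¹ :=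
    le_mul_of_one_le_left (by positivity) (one_le_pow₀ hq.le)
  have hAt : (q ^ (2 * t₀) * (q ^ s)⁻¹) ^ t₀ ≤ q ^ (-(3 * ε ^ 2 / 1024) * (n * n)) := by
    calc (q ^ (2 * t₀) * (q ^ s)⁻¹) ^ t₀ ≤ (q ^ (-(3 * ε / 16) * n)) ^ t₀ := by gcongr
      _ = q ^ (-(3 * ε / 16) * n * t₀) := (Real.rpow_mul_natCast hq0.le _ _).symm
      _ ≤ _ := Real.rpow_le_rpow_of_exponent_le hq.le (by
          have := mul_le_mul_of_nonneg_left ht₀l (by positivity : 0 ≤ 3 * ε / 16 * n)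
          nlinarith)
  refine ⟨t₀, w, M, ?_, ?_, ?_, ?_, ?_, ?_, ?_⟩
  · have : (1 : ℝ) < t₀ := by linarith
    exact_mod_cast this
  · have : 3 * (w : ℝ) < n := by nlinarith
    exact_mod_cast this
  · have h1 : η * (n * n) ≤ (α * n) * (α * n) := by
      have := mul_le_mul_of_nonneg_right (min_le_right α₂ (α ^ 2)) (by positivity : 0 ≤ (n : ℝ) * n)
      linarith
    have h2 : (α * n) * (α * n) < (w + 1) * (w + 1) :=
      mul_self_lt_mul_self (by positivity) hwl
    have : (M : ℝ) < (w + 1) * (w + 1) := by linarith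
    exact_mod_cast this
  · have := mul_le_mul_of_nonneg_right (min_le_left η α) (by positivity : 0 ≤ (n : ℝ) * n)
    linarith
  · have := mul_le_mul_of_nonneg_right (min_le_right η α) hn0
    linarith
  · exact hβ.trans (pow_le_one₀ (by positivity) hr₁.le)
  · refine add_le_add ?_ ?_
    · gcongr
    · calc (hammingBallCard F (Fin n × Fin n) M : ℝ) *
            ((q ^ (2 * t₀) * (q ^ s)⁻¹) ^ t₀ + ((q ^ s)⁻¹) ^ t₀)
          ≤ q ^ (ε ^ 2 / 1024 * (n * n)) * (q ^ (-(3 * ε ^ 2 / 1024) * (n * n)) +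
              q ^ (-(3 * ε ^ 2 / 1024) * (n * n))) := by
            gcongr
            exact (pow_le_pow_left₀ (by positivity) hB _).trans hAt
        _ = 2 * q ^ (-(ε ^ 2 / 512) * (n * n)) := by
            rw [← two_mul, mul_left_comm, ← Real.rpow_add hq0]
            congr 2
            ring
        _ ≤ 2 * q ^ (-(ε ^ 2 / 512) * n) := by
            refine mul_le_mul_of_nonneg_left
              (Real.rpow_le_rpow_of_exponent_le hq.le ?_) (by norm_num)
            have : (n : ℝ) ≤ n * n := by nlinarith
            have := mul_le_mul_of_nonneg_left this (by positivity : 0 ≤ ε ^ 2 / 512)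
            linarith
        _ = _ := by rw [Real.rpow_mul_natCast hq0.le]

end Asymptotics

theorem mainTheorem5 {F : Type*} [Field F] [Fintype F] (ε : ℝ) (hε : 0 < ε) :
    ∃ ρ : ℝ, 0 < ρ ∧ ∃ δ : ℕ → ℝ, Tendsto δ atTop (𝓝 0) ∧
      ∀ n k₁ k₂ : ℕ,
        ε * n < k₁ → (k₁ : ℝ) < (1 - ε) * n →
        ε * n < k₂ → (k₂ : ℝ) < (1 - ε) * n →
        1 - δ n ≤
          ((uniformOn (plantedCodes F n k₁)).prod (uniformOn (plantedCodes F n k₂))).real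
            {C | IsProductExpanding ρ C.1 (dualCode C.2) ∧
              IsProductExpanding ρ (dualCode C.1) C.2} := by
  classical
  rcases lt_or_ge ε 1 with hε1 | hε1
  swap
  · refine ⟨1, one_pos, 0, tendsto_const_nhds, fun n k₁ k₂ h1 h2 _ _ => ?_⟩
    have hn : (0 : ℝ) ≤ n := by positivity
    nlinarith
  obtain ⟨ρ, hρ, δ, hδ, hpar⟩ := exists_expansion_parameters (F := F) hε hε1
  -- For small `n` the value 1 makes the claim vacuous; the factor 2 covers the two pairs of codes.
  refine ⟨ρ, hρ, fun n => if 128 ≤ ε * n then 2 * δ n else 1, ?_, ?_⟩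
  · refine Tendsto.congr' ?_ (by simpa using hδ.const_mul 2)
    have : Tendsto (fun n : ℕ => ε * n) atTop atTop :=
      tendsto_natCast_atTop_atTop.const_mul_atTop hε
    filter_upwards [this.eventually_ge_atTop 128] with n hn
    rw [if_pos hn]
  intro n k₁ k₂ h₁ h₁' h₂ h₂'
  dsimp only
  split_ifs with hn
  swap
  · rw [sub_self]
    exact measureReal_nonneg
  have hn0 : (0 : ℝ) ≤ n := by positivity
  -- Then `2 * s` is about `ε * n / 2`, which fits below both `n - k` and `k - 1` with room for
  -- rounding.
  set s := ⌈ε * n / 4⌉₊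
  have hsl : ε * n / 4 ≤ s := Nat.le_ceil _
  have hsu : (s : ℝ) < ε * n / 4 + 1 := Nat.ceil_lt_add_one (by positivity)
  have hk : ∀ k : ℕ, ε * n < k → (k : ℝ) < (1 - ε) * n →
      0 < k ∧ k ≤ n ∧ 2 * s ≤ n - k ∧ 2 * s ≤ k - 1 := by
    intro k h h'
    have a1 : (0 : ℝ) < k := by linarith
    have a2 : ((2 * s + k : ℕ) : ℝ) ≤ (n : ℕ) := by push_cast; linarith
    have a3 : ((2 * s + 1 : ℕ) : ℝ) ≤ (k : ℕ) := by push_cast; linarith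
    rw [Nat.cast_le] at a2 a3
    rw [Nat.cast_pos] at a1
    omega
  obtain ⟨b₁, b₂, b₃, b₄⟩ := hk k₁ h₁ h₁'
  obtain ⟨c₁, c₂, c₃, c₄⟩ := hk k₂ h₂ h₂'
  have hnpos : 0 < n := by omega
  have := isProbabilityMeasure_uniformOn (Set.toFinite _) (plantedCodes_nonempty (F := F) b₁ b₂)
  have := isProbabilityMeasure_uniformOn (Set.toFinite _) (plantedCodes_nonempty (F := F) c₁ c₂)
  obtain ⟨t₀, w, M, ht₀, hw, hM, hρM, hρw, hsmall, hbound⟩ := hpar n s hn hsl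
  have hq : (1 : ℝ) ≤ Fintype.card F := by exact_mod_cast Fintype.card_pos (α := F)
  have hp1 : ((Fintype.card F : ℝ) ^ s)⁻¹ ≤ 1 := inv_le_one_of_one_le₀ (one_le_pow₀ hq)
  have e₁ := (IsSpread.measureReal_not_isProductExpanding_le (by positivity) hp1
    (isSpread_plantedCodes (F := F) hnpos b₂ b₃) (isSpread_dualCode_plantedCodes hnpos c₂ c₄)
    ht₀ hw hsmall hM hρ.le hρM hρw).trans hbound
  have e₂ := (IsSpread.measureReal_not_isProductExpanding_le (by positivity) hp1
    (isSpread_dualCode_plantedCodes (F := F) hnpos b₂ b₄) (isSpread_plantedCodes hnpos c₂ c₃)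
    ht₀ hw hsmall hM hρ.le hρM hρw).trans hbound
  simp only [id] at e₁ e₂
  set P := (uniformOn (plantedCodes F n k₁)).prod (uniformOn (plantedCodes F n k₂))
  have hcover : P.real Set.univ ≤ P.real
      (({C | IsProductExpanding ρ C.1 (dualCode C.2) ∧ IsProductExpanding ρ (dualCode C.1) C.2} ∪
        {C | ¬ IsProductExpanding ρ C.1 (dualCode C.2)}) ∪
        {C | ¬ IsProductExpanding ρ (dualCode C.1) C.2}) := by
    refine measureReal_mono fun C _ => ?_
    simp only [Set.mem_union, Set.mem_ofPred_eq]
    tauto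
  rw [probReal_univ] at hcover
  have u₁ := hcover.trans (measureReal_union_le _ _)
  have u₂ := u₁.trans (add_le_add_left (measureReal_union_le _ _) _)
  linarith
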